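/- Let $S$ be a noetherian scheme, let $X$ be an $S$-scheme of finite type, and let $P$ be a Brauer–Severi scheme over $S$ of relative dimension $n\ge 0$, i.e. an $S$-scheme which is isomorphic to $\mathbb P^n$ locally in the étale topology of $S$. Let $\mathrm{Br}(-)$ be the Brauer group of Azumaya algebras: isomorphism classes of Azumaya algebras modulo $\mathcal A\sim\mathcal B$ if $\mathcal A\otimes \mathcal End(E)\cong\mathcal B\otimes\mathcal End(F)$ for some locally free sheaves $E,F$ of finite, everywhere positive rank; the class of $P$ in $\mathrm{Br}(S)$ is the class of the Azumaya algebra of degree $n+1$ whose Brauer–Severi scheme (the scheme representing the functor of left ideals that are direct summands of rank $n+1$) is $P$. Let $M(S)$ be the Grothendieck ring of finite type $S$-schemes: its additive group is the free abelian group on isomorphism classes of reduced finite type $S$-schemes modulo the relations $[Y]=[U]+[Z]$ for $U\subset Y$ open with complement $Z$ (with its reduced structure), and $[Y]$ denotes the class of $Y^{\mathrm{red}}$ for any finite type $S$-scheme $Y$. Assume that the class of $P$ in $\mathrm{Br}(S)$ lies in the kernel of the pullback homomorphism $\mathrm{Br}(S)\to\mathrm{Br}(X)$. Then $$[X\times_S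 P]=[\mathbb P^n_X]\quad\text{in } M(S).$$ -/

import Mathlib

open CategoryTheory CategoryTheory.Limits AlgebraicGeometry TensorProduct

universe u

namespace BrauerSeveri

noncomputable section

/-! ### Base change of tensor products and endomorphism rings -/

/-- The canonical isomorphism `R' ⊗ (A ⊗ B) ≃ (R' ⊗ A) ⊗ (R' ⊗ B)` of `R'`-algebras. -/
def tensorBaseChangeEquiv (R R' A B : Type u) [CommRing R] [CommRing R'] [Algebra R R']
    [Ring A] [Algebra R A] [Ring B] [Algebra R B] :
    R' ⊗[R] (A ⊗[R] B) ≃ₐ[R'] (R' ⊗[R] A) ⊗[R'] (R' ⊗[R] B) :=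
  AlgEquiv.ofLinearEquiv (AlgebraTensorModule.distribBaseChange R R' A B)
    (by rw [Algebra.TensorProduct.one_def, Algebra.TensorProduct.one_def]; rfl)
    (by
      intro x y
      induction x with
      | zero => simp
      | add x₁ x₂ h₁ h₂ => simp only [add_mul, map_add, h₁, h₂]
      | tmul r s =>
        induction s with
        | zero => simp
        | add x₁ x₂ h₁ h₂ => simp only [tmul_add, add_mul, map_add, h₁, h₂]
        | tmul a b =>
          induction y with
          | zero => simp
          | add x₁ x₂ h₁ h₂ => simp only [mul_add, map_add, h₁, h₂]
          | tmul r' s' =>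
            induction s' with
            | zero => simp
            | add x₁ x₂ h₁ h₂ => simp only [tmul_add, mul_add, map_add, h₁, h₂]
            | tmul a' b' => simp [AlgebraTensorModule.distribBaseChange_tmul])

theorem tensorProductEnd_bijective (R R' M : Type u) [CommRing R] [CommRing R'] [Algebra R R']
    [AddCommGroup M] [Module R M] [Module.Finite R M] [Module.Projective R M] :
    Function.Bijective (LinearMap.tensorProductEnd R R' M) := by
  have h : ⇑(LinearMap.tensorProductEnd R R' M) =
      ⇑(((lTensorHomEquivHomLTensor R M R' M).toEquiv.trans
        (LinearMap.liftBaseChangeEquiv R' (M := M) (N := R' ⊗[R] M)).toEquiv)) := by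
    funext t
    apply AlgebraTensorModule.ext
    intro r m
    induction t with
    | zero => simp
    | add x y hx hy => simp_all
    | tmul s f =>
      trans s • (r ⊗ₜ[R] f m)
      · rfl
      · simp [smul_tmul', mul_comm]
  rw [h]
  exact Equiv.bijective _

/-- The canonical isomorphism `R' ⊗ End M ≃ End (R' ⊗ M)` for `M` finite projective. -/
def endBaseChangeEquiv (R R' M : Type u) [CommRing R] [CommRing R'] [Algebra R R']
    [AddCommGroup M] [Module R M] [Module.Finite R M] [Module.Projective R M] :
    R' ⊗[R] Module.End R M ≃ₐ[R'] Module.End R' (R' ⊗[R] M) :=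
  AlgEquiv.ofBijective (LinearMap.tensorProductEnd R R' M) (tensorProductEnd_bijective R R' M)

/-- The canonical isomorphism `End M ⊗ End N ≃ End (M ⊗ N)` for `M`, `N` finite projective. -/
def endTensorEndEquiv (R M N : Type u) [CommRing R]
    [AddCommGroup M] [Module R M] [Module.Finite R M] [Module.Projective R M]
    [AddCommGroup N] [Module R N] [Module.Finite R N] [Module.Projective R N] :
    Module.End R M ⊗[R] Module.End R N ≃ₐ[R] Module.End R (M ⊗[R] N) :=
  AlgEquiv.ofBijective Module.endTensorEndAlgHom (by
    have h : ⇑(Module.endTensorEndAlgHom (R := R) (S := R) (A := R) (M := M) (N := N)) =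
        ⇑(homTensorHomEquiv R M N M N) := by
      funext t
      rw [homTensorHomEquiv_apply]
      induction t with
      | zero => simp
      | add x y hx hy => simp_all
      | tmul s f => rfl
    rw [h]
    exact LinearEquiv.bijective _)

/-! ### Quasi-coherent algebras and vector bundles on a scheme -/

/-- `y : Spec R' ⟶ S` is the restriction of `x : Spec R ⟶ S` along `Spec R' ⟶ Spec R`. -/
def Restricts {S : Scheme.{u}} {R R' : Type u} [CommRing R] [CommRing R'] [Algebra R R']
    (x : Spec (.of R) ⟶ S) (y : Spec (.of R') ⟶ S) : Prop :=
  y = Spec.map (CommRingCat.ofHom (algebraMap R R')) ≫ x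

/-- A quasi-coherent sheaf of (associative, unital) `𝒪_S`-algebras, given by its modules of
sections over all affine schemes over `S`: an `R`-algebra for every `Spec R ⟶ S`, together with
a coherent system of base change isomorphisms. -/
structure QCAlgebra (S : Scheme.{u}) where
  obj : ∀ (R : Type u) [CommRing R], (Spec (.of R) ⟶ S) → Type u
  [ring : ∀ (R : Type u) [CommRing R] (x : Spec (.of R) ⟶ S), Ring (obj R x)]
  [algebra : ∀ (R : Type u) [CommRing R] (x : Spec (.of R) ⟶ S), Algebra R (obj R x)]
  baseChange : ∀ {R R' : Type u} [CommRing R] [CommRing R'] [Algebra R R']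
    {x : Spec (.of R) ⟶ S} {y : Spec (.of R') ⟶ S}, Restricts x y →
    (R' ⊗[R] obj R x ≃ₐ[R'] obj R' y)
  baseChange_id : ∀ {R : Type u} [CommRing R] {x : Spec (.of R) ⟶ S} (h : Restricts x x)
    (a : obj R x), baseChange h (1 ⊗ₜ[R] a) = a
  baseChange_comp : ∀ {R R' R'' : Type u} [CommRing R] [CommRing R'] [CommRing R'']
    [Algebra R R'] [Algebra R' R''] [Algebra R R''] [IsScalarTower R R' R'']
    {x : Spec (.of R) ⟶ S} {y : Spec (.of R') ⟶ S} {z : Spec (.of R'') ⟶ S}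
    (h : Restricts x y) (h' : Restricts y z) (h'' : Restricts x z) (a : obj R x),
    baseChange h' (1 ⊗ₜ[R'] baseChange h (1 ⊗ₜ[R] a)) = baseChange h'' (1 ⊗ₜ[R] a)

attribute [instance] QCAlgebra.ring QCAlgebra.algebra

/-- A locally free sheaf of finite rank on `S`, given by its modules of sections over all affine
schemes over `S`: a finite projective `R`-module for every `Spec R ⟶ S`, together with
a coherent system of base change isomorphisms. -/
structure LocFree (S : Scheme.{u}) where
  obj : ∀ (R : Type u) [CommRing R], (Spec (.of R) ⟶ S) → Type u
  [addCommGroup : ∀ (R : Type u) [CommRing R] (x : Spec (.of R) ⟶ S), AddCommGroup (obj R x)]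
  [module : ∀ (R : Type u) [CommRing R] (x : Spec (.of R) ⟶ S), Module R (obj R x)]
  [finite : ∀ (R : Type u) [CommRing R] (x : Spec (.of R) ⟶ S), Module.Finite R (obj R x)]
  [projective : ∀ (R : Type u) [CommRing R] (x : Spec (.of R) ⟶ S),
    Module.Projective R (obj R x)]
  baseChange : ∀ {R R' : Type u} [CommRing R] [CommRing R'] [Algebra R R']
    {x : Spec (.of R) ⟶ S} {y : Spec (.of R') ⟶ S}, Restricts x y →
    (R' ⊗[R] obj R x ≃ₗ[R'] obj R' y)
  baseChange_id : ∀ {R : Type u} [CommRing R] {x : Spec (.of R) ⟶ S} (h : Restricts x x)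
    (a : obj R x), baseChange h (1 ⊗ₜ[R] a) = a
  baseChange_comp : ∀ {R R' R'' : Type u} [CommRing R] [CommRing R'] [CommRing R'']
    [Algebra R R'] [Algebra R' R''] [Algebra R R''] [IsScalarTower R R' R'']
    {x : Spec (.of R) ⟶ S} {y : Spec (.of R') ⟶ S} {z : Spec (.of R'') ⟶ S}
    (h : Restricts x y) (h' : Restricts y z) (h'' : Restricts x z) (a : obj R x),
    baseChange h' (1 ⊗ₜ[R'] baseChange h (1 ⊗ₜ[R] a)) = baseChange h'' (1 ⊗ₜ[R] a)

attribute [instance] LocFree.addCommGroup LocFree.module LocFree.finite LocFree.projective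

namespace QCAlgebra

variable {S T : Scheme.{u}}

/-- The restriction map on sections along `Spec R' ⟶ Spec R` over `S`. -/
def res (A : QCAlgebra S) {R R' : Type u} [CommRing R] [CommRing R'] [Algebra R R']
    {x : Spec (.of R) ⟶ S} {y : Spec (.of R') ⟶ S} (h : Restricts x y) : A.obj R x →+* A.obj R' y :=
  (A.baseChange h).toRingEquiv.toRingHom.comp
    (Algebra.TensorProduct.includeRight : A.obj R x →ₐ[R] R' ⊗[R] A.obj R x).toRingHom

theorem res_apply (A : QCAlgebra S) {R R' : Type u} [CommRing R] [CommRing R'] [Algebra R R']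
    {x : Spec (.of R) ⟶ S} {y : Spec (.of R') ⟶ S} (h : Restricts x y) (a : A.obj R x) :
    A.res h a = A.baseChange h (1 ⊗ₜ a) := rfl

/-- An isomorphism of quasi-coherent algebras. -/
structure Iso (A B : QCAlgebra S) where
  equiv : ∀ (R : Type u) [CommRing R] (x : Spec (.of R) ⟶ S), A.obj R x ≃ₐ[R] B.obj R x
  naturality : ∀ {R R' : Type u} [CommRing R] [CommRing R'] [Algebra R R']
    {x : Spec (.of R) ⟶ S} {y : Spec (.of R') ⟶ S} (h : Restricts x y) (a : A.obj R x),
    equiv R' y (A.res h a) = B.res h (equiv R x a)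

/-- The inverse image of a quasi-coherent algebra. -/
def pullback (f : T ⟶ S) (A : QCAlgebra S) : QCAlgebra T where
  obj R _ x := A.obj R (x ≫ f)
  baseChange h := A.baseChange (by unfold Restricts at *; rw [h, Category.assoc])
  baseChange_id _ a := A.baseChange_id _ a
  baseChange_comp _ _ _ a := A.baseChange_comp _ _ _ a

/-- The structure sheaf `𝒪_S`, as an algebra over itself. -/
def structureSheaf (S : Scheme.{u}) : QCAlgebra S where
  obj R _ _ := R
  ring _ _ _ := inferInstance
  algebra _ _ _ := inferInstance
  baseChange {R R'} _ _ _ _ _ _ := Algebra.TensorProduct.rid R R' R'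
  baseChange_id _ a := by simp
  baseChange_comp {R R' R''} _ _ _ _ _ _ _ _ _ _ _ _ _ a := by
    simp [Algebra.smul_def, ← IsScalarTower.algebraMap_apply]

/-- The tensor product of two quasi-coherent algebras. -/
def tensor (A B : QCAlgebra S) : QCAlgebra S where
  obj R _ x := A.obj R x ⊗[R] B.obj R x
  baseChange {R R'} _ _ _ x y h := (tensorBaseChangeEquiv R R' (A.obj R x) (B.obj R x)).trans
    (Algebra.TensorProduct.congr (A.baseChange h) (B.baseChange h))
  baseChange_id {R _ x} h a := by
    induction a with
    | zero => simp
    | add x y hx hy => simp only [tmul_add, map_add, hx, hy]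
    | tmul a b =>
      trans A.baseChange h (1 ⊗ₜ a) ⊗ₜ[R] B.baseChange h (1 ⊗ₜ b)
      · rfl
      · rw [A.baseChange_id, B.baseChange_id]
  baseChange_comp {R R' R''} _ _ _ _ _ _ _ x y z h h' h'' a := by
    induction a with
    | zero => simp
    | add x y hx hy => simp only [tmul_add, map_add, hx, hy]
    | tmul a b =>
      trans A.baseChange h' (1 ⊗ₜ A.baseChange h (1 ⊗ₜ a)) ⊗ₜ[R'']
        B.baseChange h' (1 ⊗ₜ B.baseChange h (1 ⊗ₜ b))
      · rfl
      · rw [A.baseChange_comp h h' h'', B.baseChange_comp h h' h'']; rfl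

theorem tensor_res_tmul (A B : QCAlgebra S) {R R' : Type u} [CommRing R] [CommRing R']
    [Algebra R R'] {x : Spec (.of R) ⟶ S} {y : Spec (.of R') ⟶ S} (h : Restricts x y)
    (a : A.obj R x) (b : B.obj R x) :
    (A.tensor B).res h (a ⊗ₜ[R] b) = A.res h a ⊗ₜ[R'] B.res h b := rfl

theorem tensor_induction {A B : QCAlgebra S} {R : Type u} [CommRing R] {x : Spec (.of R) ⟶ S}
    {motive : (A.tensor B).obj R x → Prop} (t : (A.tensor B).obj R x) (zero : motive 0)
    (add : ∀ s t, motive s → motive t → motive (s + t))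
    (tmul : ∀ (a : A.obj R x) (b : B.obj R x), motive (a ⊗ₜ[R] b)) : motive t :=
  TensorProduct.induction_on t zero tmul add

/-- The section `a ⊗ b` of `A ⊗ B`. -/
def pure {A B : QCAlgebra S} {R : Type u} [CommRing R] {x : Spec (.of R) ⟶ S} (a : A.obj R x)
    (b : B.obj R x) : (A.tensor B).obj R x := a ⊗ₜ[R] b

theorem zero_pure {A B : QCAlgebra S} {R : Type u} [CommRing R] {x : Spec (.of R) ⟶ S}
    (b : B.obj R x) : pure (0 : A.obj R x) b = 0 := zero_tmul _ _

theorem add_pure {A B : QCAlgebra S} {R : Type u} [CommRing R] {x : Spec (.of R) ⟶ S}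
    (a a' : A.obj R x) (b : B.obj R x) : pure (a + a') b = pure a b + pure a' b := add_tmul _ _ _

end QCAlgebra

namespace LocFree

variable {S T : Scheme.{u}}

/-- The restriction map on sections along `Spec R' ⟶ Spec R` over `S`. -/
def res (E : LocFree S) {R R' : Type u} [CommRing R] [CommRing R'] [Algebra R R']
    {x : Spec (.of R) ⟶ S} {y : Spec (.of R') ⟶ S} (h : Restricts x y) (m : E.obj R x) :
    E.obj R' y :=
  E.baseChange h (1 ⊗ₜ m)

theorem res_hom_ext (E : LocFree S) {R R' : Type u} [CommRing R] [CommRing R'] [Algebra R R']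
    {x : Spec (.of R) ⟶ S} {y : Spec (.of R') ⟶ S} (h : Restricts x y) {N : Type u}
    [AddCommGroup N] [Module R' N] {f g : E.obj R' y →ₗ[R'] N}
    (H : ∀ m, f (E.res h m) = g (E.res h m)) : f = g := by
  apply LinearMap.ext
  intro m
  obtain ⟨t, rfl⟩ := (E.baseChange h).surjective m
  induction t with
  | zero => simp
  | add a b ha hb => simp only [map_add, ha, hb]
  | tmul r m =>
    have : r ⊗ₜ[R] m = r • ((1 : R') ⊗ₜ[R] m) := by simp [smul_tmul']
    rw [this, map_smul, map_smul, map_smul]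
    exact congrArg (r • ·) (H m)

/-- `E` has positive rank at every point. -/
def IsPositive (E : LocFree S) : Prop :=
  ∀ (R : Type u) [CommRing R] (x : Spec (.of R) ⟶ S) (p : PrimeSpectrum R),
    0 < Module.rankAtStalk (E.obj R x) p

/-- The inverse image of a locally free sheaf. -/
def pullback (f : T ⟶ S) (E : LocFree S) : LocFree T where
  obj R _ x := E.obj R (x ≫ f)
  baseChange h := E.baseChange (by unfold Restricts at *; rw [h, Category.assoc])
  baseChange_id _ a := E.baseChange_id _ a
  baseChange_comp _ _ _ a := E.baseChange_comp _ _ _ a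

/-- The structure sheaf `𝒪_S`, as a locally free sheaf. -/
def unit (S : Scheme.{u}) : LocFree S where
  obj R _ _ := R
  addCommGroup _ _ _ := inferInstance
  module _ _ _ := inferInstance
  finite R _ _ := inferInstanceAs (Module.Finite R R)
  projective R _ _ := inferInstanceAs (Module.Projective R R)
  baseChange {R R'} _ _ _ _ _ _ := (Algebra.TensorProduct.rid R R' R').toLinearEquiv
  baseChange_id _ a := by simp
  baseChange_comp {R R' R''} _ _ _ _ _ _ _ _ _ _ _ _ _ a := by
    simp [Algebra.smul_def, ← IsScalarTower.algebraMap_apply]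

/-- The tensor product of two locally free sheaves. -/
def tensor (E F : LocFree S) : LocFree S where
  obj R _ x := E.obj R x ⊗[R] F.obj R x
  baseChange {R R'} _ _ _ x y h :=
    (AlgebraTensorModule.distribBaseChange R R' (E.obj R x) (F.obj R x)).trans
      (TensorProduct.congr (E.baseChange h) (F.baseChange h))
  baseChange_id {R _ x} h a := by
    induction a with
    | zero => simp
    | add x y hx hy => simp only [tmul_add, map_add, hx, hy]
    | tmul a b =>
      trans E.baseChange h (1 ⊗ₜ a) ⊗ₜ[R] F.baseChange h (1 ⊗ₜ b)
      · rfl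
      · rw [E.baseChange_id, F.baseChange_id]
  baseChange_comp {R R' R''} _ _ _ _ _ _ _ x y z h h' h'' a := by
    induction a with
    | zero => simp
    | add x y hx hy => simp only [tmul_add, map_add, hx, hy]
    | tmul a b =>
      trans E.baseChange h' (1 ⊗ₜ E.baseChange h (1 ⊗ₜ a)) ⊗ₜ[R'']
        F.baseChange h' (1 ⊗ₜ F.baseChange h (1 ⊗ₜ b))
      · rfl
      · rw [E.baseChange_comp h h' h'', F.baseChange_comp h h' h'']; rfl

theorem tensor_induction {E F : LocFree S} {R : Type u} [CommRing R] {x : Spec (.of R) ⟶ S}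
    {motive : (E.tensor F).obj R x → Prop} (t : (E.tensor F).obj R x) (zero : motive 0)
    (add : ∀ s t, motive s → motive t → motive (s + t))
    (tmul : ∀ (a : E.obj R x) (b : F.obj R x), motive (a ⊗ₜ[R] b)) : motive t :=
  TensorProduct.induction_on t zero tmul add

theorem tensor_res_hom_ext {E F : LocFree S} {R R' : Type u} [CommRing R] [CommRing R']
    [Algebra R R'] {x : Spec (.of R) ⟶ S} {y : Spec (.of R') ⟶ S} (h : Restricts x y)
    {N : Type u} [AddCommGroup N] [Module R' N] {f g : (E.tensor F).obj R' y →ₗ[R'] N}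
    (H : ∀ (m : E.obj R x) (n : F.obj R x), f (E.res h m ⊗ₜ[R'] F.res h n) =
      g (E.res h m ⊗ₜ[R'] F.res h n)) : f = g := by
  apply (E.tensor F).res_hom_ext h
  intro t
  induction t using tensor_induction with
  | zero => simp only [res, tmul_zero, map_zero]
  | add s t hs ht =>
    simp only [res, tmul_add, map_add] at hs ht ⊢
    rw [hs, ht]
  | tmul m n => exact H m n

theorem IsPositive.pullback {E : LocFree S} (hE : E.IsPositive) (f : T ⟶ S) :
    (E.pullback f).IsPositive :=
  fun R _ x p => hE R (x ≫ f) p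

theorem isPositive_unit (S : Scheme.{u}) : (unit S).IsPositive := fun R _ x p => by
  have := p.nontrivial
  change 0 < Module.rankAtStalk R p
  simp

theorem IsPositive.tensor {E F : LocFree S} (hE : E.IsPositive) (hF : F.IsPositive) :
    (E.tensor F).IsPositive := fun R _ x p => by
  change 0 < Module.rankAtStalk (E.obj R x ⊗[R] F.obj R x) p
  rw [Module.rankAtStalk_tensorProduct]
  exact Nat.mul_pos (hE R x p) (hF R x p)

theorem conj_endBaseChange_apply (E : LocFree S) {R R' : Type u} [CommRing R] [CommRing R']
    [Algebra R R'] {x : Spec (.of R) ⟶ S} {y : Spec (.of R') ⟶ S} (h : Restricts x y)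
    (φ : Module.End R (E.obj R x)) (m : E.obj R x) :
    (((endBaseChangeEquiv R R' (E.obj R x)).trans ((E.baseChange h).conjAlgEquiv R'))
      (1 ⊗ₜ φ) : Module.End R' (E.obj R' y)) (E.res h m) = E.res h (φ m) := by
  change E.baseChange h ((endBaseChangeEquiv R R' (E.obj R x) (1 ⊗ₜ φ))
    ((E.baseChange h).symm (E.baseChange h (1 ⊗ₜ m)))) = E.baseChange h (1 ⊗ₜ φ m)
  rw [LinearEquiv.symm_apply_apply]
  change E.baseChange h ((1 : R') • ((1 : R') ⊗ₜ[R] φ m)) = _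
  rw [one_smul]

/-- The quasi-coherent algebra `End(E)` of endomorphisms of a locally free sheaf `E`. -/
def endAlg (E : LocFree S) : QCAlgebra S where
  obj R _ x := Module.End R (E.obj R x)
  ring _ _ _ := inferInstance
  algebra R _ x := inferInstanceAs (Algebra R (Module.End R (E.obj R x)))
  baseChange {R R'} _ _ _ x y h := (endBaseChangeEquiv R R' (E.obj R x)).trans
    ((E.baseChange h).conjAlgEquiv R')
  baseChange_id {R _ x} h φ := by
    apply E.res_hom_ext h
    intro m
    rw [conj_endBaseChange_apply]
    exact (E.baseChange_id h (φ m)).trans (congrArg φ (E.baseChange_id h m).symm)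
  baseChange_comp {R R' R''} _ _ _ _ _ _ _ x y z h h' h'' φ := by
    apply E.res_hom_ext h''
    intro m
    rw [conj_endBaseChange_apply]
    have H : ∀ n : E.obj R x, E.res h'' n = E.res h' (E.res h n) := fun n =>
      (E.baseChange_comp h h' h'' n).symm
    rw [H, H, conj_endBaseChange_apply, conj_endBaseChange_apply]

theorem endAlg_res_apply (E : LocFree S) {R R' : Type u} [CommRing R] [CommRing R']
    [Algebra R R'] {x : Spec (.of R) ⟶ S} {y : Spec (.of R') ⟶ S} (h : Restricts x y)
    (φ : Module.End R (E.obj R x)) (m : E.obj R x) :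
    DFunLike.coe (F := Module.End R' (E.obj R' y)) (E.endAlg.res h φ) (E.res h m) =
      E.res h (φ m) :=
  conj_endBaseChange_apply E h φ m

end LocFree

namespace QCAlgebra

variable {S T : Scheme.{u}}

/-- The opposite of a quasi-coherent algebra. -/
def op (A : QCAlgebra S) : QCAlgebra S where
  obj R _ x := (A.obj R x)ᵐᵒᵖ
  ring _ _ _ := inferInstance
  algebra _ _ _ := inferInstance
  baseChange {R R'} _ _ _ x _ h :=
    ((Algebra.TensorProduct.congr (AlgEquiv.toOpposite R' R')
      (AlgEquiv.refl : (A.obj R x)ᵐᵒᵖ ≃ₐ[R] (A.obj R x)ᵐᵒᵖ)).trans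
      (Algebra.TensorProduct.opAlgEquiv R R' R' (A.obj R x))).trans (A.baseChange h).op
  baseChange_id h a := congrArg MulOpposite.op (A.baseChange_id h a.unop)
  baseChange_comp h h' h'' a := congrArg MulOpposite.op (A.baseChange_comp h h' h'' a.unop)

theorem op_res (A : QCAlgebra S) {R R' : Type u} [CommRing R] [CommRing R'] [Algebra R R']
    {x : Spec (.of R) ⟶ S} {y : Spec (.of R') ⟶ S} (h : Restricts x y) (a : A.obj R x) :
    A.op.res h (MulOpposite.op a) = MulOpposite.op (A.res h a) := rfl

namespace Iso

/-- The identity isomorphism. -/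
def refl (A : QCAlgebra S) : Iso A A where
  equiv _ _ _ := AlgEquiv.refl
  naturality _ _ := rfl

/-- The inverse isomorphism. -/
def symm {A B : QCAlgebra S} (e : Iso A B) : Iso B A where
  equiv R _ x := (e.equiv R x).symm
  naturality h b := by
    rw [AlgEquiv.symm_apply_eq, e.naturality, AlgEquiv.apply_symm_apply]

/-- Composition of isomorphisms. -/
def trans {A B C : QCAlgebra S} (e : Iso A B) (f : Iso B C) : Iso A C where
  equiv R _ x := (e.equiv R x).trans (f.equiv R x)
  naturality h a := by
    rw [AlgEquiv.trans_apply, AlgEquiv.trans_apply, e.naturality, f.naturality]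

/-- Inverse image of an isomorphism. -/
def pullback {A B : QCAlgebra S} (e : Iso A B) (f : T ⟶ S) :
    Iso (A.pullback f) (B.pullback f) where
  equiv R _ x := e.equiv R (x ≫ f)
  naturality _ a := e.naturality _ a

/-- An isomorphism out of a tensor product may be checked on pure tensors. -/
def ofTensor {A B C : QCAlgebra S}
    (e : ∀ (R : Type u) [CommRing R] (x : Spec (.of R) ⟶ S),
      (A.tensor B).obj R x ≃ₐ[R] C.obj R x)
    (H : ∀ {R R' : Type u} [CommRing R] [CommRing R'] [Algebra R R']
      {x : Spec (.of R) ⟶ S} {y : Spec (.of R') ⟶ S} (h : Restricts x y) (a : A.obj R x)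
      (b : B.obj R x), e R' y (A.res h a ⊗ₜ[R'] B.res h b) = C.res h (e R x (a ⊗ₜ[R] b))) :
    Iso (A.tensor B) C where
  equiv := e
  naturality {R R'} _ _ _ x y h a := by
    induction a using tensor_induction with
    | zero => simp only [map_zero]
    | add x y hx hy => simp only [map_add, hx, hy]
    | tmul a b => exact H h a b

/-- An isomorphism out of a triple tensor product may be checked on pure tensors. -/
def ofTensor₂ {A B C D : QCAlgebra S}
    (e : ∀ (R : Type u) [CommRing R] (x : Spec (.of R) ⟶ S),
      ((A.tensor B).tensor C).obj R x ≃ₐ[R] D.obj R x)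
    (H : ∀ {R R' : Type u} [CommRing R] [CommRing R'] [Algebra R R']
      {x : Spec (.of R) ⟶ S} {y : Spec (.of R') ⟶ S} (h : Restricts x y) (a : A.obj R x)
      (b : B.obj R x) (c : C.obj R x),
      e R' y (pure (pure (A.res h a) (B.res h b)) (C.res h c)) =
        D.res h (e R x (pure (pure a b) c))) :
    Iso ((A.tensor B).tensor C) D :=
  ofTensor e fun {R R'} _ _ _ x y h t c => by
    change e R' y (pure ((A.tensor B).res h t) (C.res h c)) = D.res h (e R x (pure t c))
    induction t using tensor_induction with
    | zero => simp only [map_zero, zero_pure]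
    | add x y hx hy => simp only [map_add, add_pure, hx, hy]
    | tmul a b => exact H h a b c

/-- Tensor product of isomorphisms. -/
def tensor {A B A' B' : QCAlgebra S} (e : Iso A B) (e' : Iso A' B') :
    Iso (A.tensor A') (B.tensor B') :=
  ofTensor (fun R _ x => Algebra.TensorProduct.congr (e.equiv R x) (e'.equiv R x))
    fun {R R'} _ _ _ x y h a b => by
      refine Eq.trans (b := pure (e.equiv R' y (A.res h a)) (e'.equiv R' y (A'.res h b))) ?_ ?_
      · rfl
      · rw [e.naturality, e'.naturality]; rfl

/-- Commutativity of the tensor product. -/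
def comm (A B : QCAlgebra S) : Iso (A.tensor B) (B.tensor A) :=
  ofTensor (fun R _ x => Algebra.TensorProduct.comm R (A.obj R x) (B.obj R x)) fun _ _ _ => rfl

/-- Associativity of the tensor product. -/
def assoc (A B C : QCAlgebra S) : Iso ((A.tensor B).tensor C) (A.tensor (B.tensor C)) :=
  ofTensor₂ (fun R _ x => Algebra.TensorProduct.assoc R R R (A.obj R x) (B.obj R x) (C.obj R x))
    fun _ _ _ _ => rfl

/-- The structure sheaf is a unit for the tensor product. -/
def tensorUnit (A : QCAlgebra S) : Iso (A.tensor (structureSheaf S)) A :=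
  ofTensor (fun R _ x => Algebra.TensorProduct.rid R R (A.obj R x))
    fun {R R'} _ _ _ x y h a (r : R) => by
      change (r • (1 : R')) • A.baseChange h (1 ⊗ₜ a) = A.baseChange h (1 ⊗ₜ (r • a))
      rw [← map_smul, smul_tmul', tmul_smul, smul_tmul']
      simp

/-- `End(E) ⊗ End(F) ≅ End(E ⊗ F)`. -/
def endTensor (E F : LocFree S) : Iso (E.endAlg.tensor F.endAlg) (E.tensor F).endAlg :=
  ofTensor (fun R _ x => endTensorEndEquiv R (E.obj R x) (F.obj R x))
    fun {R R'} _ _ _ x y h φ ψ => by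
      apply LocFree.tensor_res_hom_ext h
      intro m n
      refine Eq.trans ?_ (LocFree.endAlg_res_apply (E.tensor F) h _ (m ⊗ₜ[R] n)).symm
      refine Eq.trans (b :=
        (DFunLike.coe (F := Module.End R' (E.obj R' y)) (E.endAlg.res h φ) (E.res h m)) ⊗ₜ[R']
        (DFunLike.coe (F := Module.End R' (F.obj R' y)) (F.endAlg.res h ψ) (F.res h n))) ?_ ?_
      · rfl
      · exact congrArg₂ (fun (a : E.obj R' y) (b : F.obj R' y) => a ⊗ₜ[R'] b)
          (LocFree.endAlg_res_apply E h φ m) (LocFree.endAlg_res_apply F h ψ n)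

/-- `𝒪 ≅ End(𝒪)`. -/
def unitEnd (S : Scheme.{u}) : Iso (structureSheaf S) (LocFree.unit S).endAlg where
  equiv R _ x := (AlgEquiv.toOpposite R R).trans (AlgEquiv.moduleEndSelf R)
  naturality {R R'} _ _ _ x y h (a : R) := by
    apply (LocFree.unit S).res_hom_ext h
    intro (m : R)
    refine Eq.trans ?_ (LocFree.endAlg_res_apply (.unit S) h _ m).symm
    change (m • (1 : R')) * (a • (1 : R')) = (m * a) • (1 : R')
    simp [Algebra.smul_def]

end Iso

end QCAlgebra

/-! ### The Brauer group -/

/-- An Azumaya algebra on the scheme `S`. -/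
structure Azumaya (S : Scheme.{u}) extends QCAlgebra S where
  isAzumaya : ∀ (R : Type u) [CommRing R] (x : Spec (.of R) ⟶ S), IsAzumaya R (obj R x)

theorem isAzumaya_tensor (R A B : Type u) [CommRing R] [Ring A] [Algebra R A] [Ring B]
    [Algebra R B] [IsAzumaya R A] [IsAzumaya R B] : IsAzumaya R (A ⊗[R] B) := by
  have hA : Function.Injective (algebraMap R A) := FaithfulSMul.algebraMap_injective R A
  have hB : Function.Injective (algebraMap R B) := FaithfulSMul.algebraMap_injective R B
  have hf : FaithfulSMul R (A ⊗[R] B) := by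
    rw [faithfulSMul_iff_algebraMap_injective]
    have h : ⇑(algebraMap R (A ⊗[R] B)) =
        (Algebra.TensorProduct.includeRight : B →ₐ[R] A ⊗[R] B) ∘ algebraMap R B := by
      funext r
      simp
    rw [h]
    exact (Algebra.TensorProduct.includeRight_injective hA).comp hB
  refine { hf with bij := ?_ }
  let e : (A ⊗[R] Aᵐᵒᵖ) ⊗[R] (B ⊗[R] Bᵐᵒᵖ) ≃ₐ[R] (A ⊗[R] B) ⊗[R] (A ⊗[R] B)ᵐᵒᵖ :=
    (Algebra.TensorProduct.tensorTensorTensorComm R R R R A Aᵐᵒᵖ B Bᵐᵒᵖ).trans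
      (Algebra.TensorProduct.congr AlgEquiv.refl (Algebra.TensorProduct.opAlgEquiv R R A B))
  let f : (A ⊗[R] Aᵐᵒᵖ) ⊗[R] (B ⊗[R] Bᵐᵒᵖ) ≃ₐ[R] Module.End R (A ⊗[R] B) :=
    (Algebra.TensorProduct.congr
      (AlgEquiv.ofBijective (AlgHom.mulLeftRight R A) IsAzumaya.bij)
      (AlgEquiv.ofBijective (AlgHom.mulLeftRight R B) IsAzumaya.bij)).trans
      (endTensorEndEquiv R A B)
  have h : ⇑(AlgHom.mulLeftRight R (A ⊗[R] B)) ∘ ⇑e = ⇑f := by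
    funext t
    induction t with
    | zero => simp
    | add x y hx hy => simp only [Function.comp_apply, map_add] at hx hy ⊢; rw [hx, hy]
    | tmul s t =>
      induction s with
      | zero => simp
      | add x y hx hy =>
        simp only [Function.comp_apply, add_tmul, map_add] at hx hy ⊢; rw [hx, hy]
      | tmul a a' =>
        induction t with
        | zero => simp
        | add x y hx hy =>
          simp only [Function.comp_apply, tmul_add, map_add] at hx hy ⊢; rw [hx, hy]
        | tmul b b' =>
          apply TensorProduct.ext'
          intro c d
          trans (a * c * a'.unop) ⊗ₜ[R] (b * d * b'.unop)
          · change (AlgHom.mulLeftRight R (A ⊗[R] B)) ((a ⊗ₜ b) ⊗ₜ MulOpposite.op (a'.unop ⊗ₜ b'.unop))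
              (c ⊗ₜ d) = _
            simp
          · change _ = AlgHom.mulLeftRight R A (a ⊗ₜ a') c ⊗ₜ[R] AlgHom.mulLeftRight R B (b ⊗ₜ b') d
            simp
  rw [← Function.Bijective.of_comp_iff _ e.bijective, h]
  exact f.bijective

theorem isAzumaya_op (R A : Type u) [CommRing R] [Ring A] [Algebra R A] [IsAzumaya R A] :
    IsAzumaya R Aᵐᵒᵖ := by
  have hp : Module.Projective R Aᵐᵒᵖ := .of_equiv (MulOpposite.opLinearEquiv R)
  have hf : Module.Finite R Aᵐᵒᵖ := .equiv (MulOpposite.opLinearEquiv R)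
  have hs : FaithfulSMul R Aᵐᵒᵖ := by
    rw [faithfulSMul_iff_algebraMap_injective]
    exact MulOpposite.op_injective.comp (FaithfulSMul.algebraMap_injective R A)
  refine { hp, hf, hs with bij := ?_ }
  let e : A ⊗[R] Aᵐᵒᵖ ≃ₐ[R] Aᵐᵒᵖ ⊗[R] Aᵐᵒᵖᵐᵒᵖ :=
    (Algebra.TensorProduct.comm R A Aᵐᵒᵖ).trans
      (Algebra.TensorProduct.congr AlgEquiv.refl (AlgEquiv.opOp R A))
  let f : A ⊗[R] Aᵐᵒᵖ ≃ₐ[R] Module.End R Aᵐᵒᵖ :=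
    (AlgEquiv.ofBijective (AlgHom.mulLeftRight R A) IsAzumaya.bij).trans
      ((MulOpposite.opLinearEquiv R).conjAlgEquiv R)
  have h : ⇑(AlgHom.mulLeftRight R Aᵐᵒᵖ) ∘ ⇑e = ⇑f := by
    funext t
    induction t with
    | zero => simp
    | add x y hx hy => simp only [Function.comp_apply, map_add] at hx hy ⊢; rw [hx, hy]
    | tmul a b =>
      apply LinearMap.ext
      intro c
      trans MulOpposite.op (a * c.unop * b.unop)
      · change AlgHom.mulLeftRight R Aᵐᵒᵖ (b ⊗ₜ MulOpposite.op (MulOpposite.op a)) c = _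
        rw [AlgHom.mulLeftRight_apply]
        apply MulOpposite.unop_injective
        simp [mul_assoc]
      · change _ = MulOpposite.op (AlgHom.mulLeftRight R A (a ⊗ₜ b) c.unop)
        simp
  rw [← Function.Bijective.of_comp_iff _ e.bijective, h]
  exact f.bijective

namespace Azumaya

variable {S T : Scheme.{u}}

/-- The inverse image of an Azumaya algebra. -/
def pullback (f : T ⟶ S) (A : Azumaya S) : Azumaya T where
  toQCAlgebra := A.toQCAlgebra.pullback f
  isAzumaya R _ x := A.isAzumaya R (x ≫ f)

/-- The trivial Azumaya algebra `𝒪_S`. -/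
def trivial (S : Scheme.{u}) : Azumaya S where
  toQCAlgebra := .structureSheaf S
  isAzumaya R _ _ := inferInstanceAs (IsAzumaya R R)

/-- The tensor product of two Azumaya algebras. -/
def tensor (A B : Azumaya S) : Azumaya S where
  toQCAlgebra := A.toQCAlgebra.tensor B.toQCAlgebra
  isAzumaya R _ x :=
    have := A.isAzumaya R x
    have := B.isAzumaya R x
    isAzumaya_tensor R (A.obj R x) (B.obj R x)

/-- The opposite of an Azumaya algebra. -/
def op (A : Azumaya S) : Azumaya S where
  toQCAlgebra := A.toQCAlgebra.op
  isAzumaya R _ x :=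
    have := A.isAzumaya R x
    isAzumaya_op R (A.obj R x)

/-- The locally free sheaf underlying an Azumaya algebra. -/
def toLocFree (A : Azumaya S) : LocFree S where
  obj R _ x := A.obj R x
  addCommGroup _ _ _ := inferInstance
  module _ _ _ := inferInstance
  finite R _ x := (A.isAzumaya R x).toFinite
  projective R _ x := (A.isAzumaya R x).toProjective
  baseChange h := (A.baseChange h).toLinearEquiv
  baseChange_id h a := A.baseChange_id h a
  baseChange_comp h h' h'' a := A.baseChange_comp h h' h'' a

theorem isPositive_toLocFree (A : Azumaya S) : A.toLocFree.IsPositive := by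
  intro R _ x p
  have := A.isAzumaya R x
  have : Module.Flat R (A.obj R x) := inferInstance
  change 0 < Module.rankAtStalk (A.obj R x) p
  rw [Module.rankAtStalk_pos_iff_mem_support, Module.support_of_algebra,
    (RingHom.injective_iff_ker_eq_bot _).mp (FaithfulSMul.algebraMap_injective R (A.obj R x))]
  simp

/-- `A ⊗ Aᵒᵖ ≅ End(A)` for an Azumaya algebra `A`. -/
def tensorOp (A : Azumaya S) :
    (A.toQCAlgebra.tensor A.toQCAlgebra.op).Iso A.toLocFree.endAlg :=
  .ofTensor
    (fun R _ x => AlgEquiv.ofBijective (AlgHom.mulLeftRight R (A.obj R x)) (A.isAzumaya R x).bij)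
    fun {R R'} _ _ _ x y h a b => by
      apply A.toLocFree.res_hom_ext h
      intro (m : A.obj R x)
      refine Eq.trans ?_ (LocFree.endAlg_res_apply A.toLocFree h _ m).symm
      refine Eq.trans (b := A.res h a * A.res h m * A.res h b.unop) ?_ ?_
      · exact AlgHom.mulLeftRight_apply R' (A.obj R' y) _ _ _
      · refine Eq.trans (b := A.res h (a * m * b.unop)) (by rw [map_mul, map_mul]) ?_
        exact congrArg (A.res h) (AlgHom.mulLeftRight_apply R (A.obj R x) a b m).symm

/-- Brauer equivalence: `A ⊗ End(E) ≅ B ⊗ End(F)` for locally free sheaves `E`, `F` of positive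
finite rank. -/
def BrauerEquiv (A B : Azumaya S) : Prop :=
  ∃ E F : LocFree S, E.IsPositive ∧ F.IsPositive ∧
    Nonempty ((A.toQCAlgebra.tensor E.endAlg).Iso (B.toQCAlgebra.tensor F.endAlg))

theorem BrauerEquiv.of_iso {A B : Azumaya S} (e : A.toQCAlgebra.Iso B.toQCAlgebra) :
    BrauerEquiv A B :=
  ⟨.unit S, .unit S, LocFree.isPositive_unit S, LocFree.isPositive_unit S, ⟨e.tensor (.refl _)⟩⟩

theorem BrauerEquiv.symm {A B : Azumaya S} : BrauerEquiv A B → BrauerEquiv B A :=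
  fun ⟨E, F, hE, hF, ⟨e⟩⟩ => ⟨F, E, hF, hE, ⟨e.symm⟩⟩

theorem BrauerEquiv.trans {A B C : Azumaya S} :
    BrauerEquiv A B → BrauerEquiv B C → BrauerEquiv A C :=
  fun ⟨E, F, hE, hF, ⟨e⟩⟩ ⟨E', F', hE', hF', ⟨e'⟩⟩ => by
    refine ⟨E.tensor E', F'.tensor F, hE.tensor hE', hF'.tensor hF, ⟨?_⟩⟩
    -- `A E E' ≅ B F E' ≅ B E' F ≅ C F' F`
    let i₁ := ((QCAlgebra.Iso.refl A.toQCAlgebra).tensor (QCAlgebra.Iso.endTensor E E')).symm.trans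
      ((QCAlgebra.Iso.assoc _ _ _).symm.trans (e.tensor (.refl E'.endAlg)))
    let i₂ := (QCAlgebra.Iso.assoc B.toQCAlgebra F.endAlg E'.endAlg).trans
      (((QCAlgebra.Iso.refl B.toQCAlgebra).tensor (.comm _ _)).trans (.symm (.assoc _ _ _)))
    let i₃ := (e'.tensor (.refl F.endAlg)).trans ((QCAlgebra.Iso.assoc _ _ _).trans
      ((QCAlgebra.Iso.refl C.toQCAlgebra).tensor (QCAlgebra.Iso.endTensor F' F)))
    exact i₁.trans (i₂.trans i₃)

theorem BrauerEquiv.tensor_right {A B : Azumaya S} (C : Azumaya S) :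
    BrauerEquiv A B → BrauerEquiv (A.tensor C) (B.tensor C) :=
  fun ⟨E, F, hE, hF, ⟨e⟩⟩ => by
    have swap (D E : QCAlgebra S) :
        ((D.tensor C.toQCAlgebra).tensor E).Iso ((D.tensor E).tensor C.toQCAlgebra) :=
      (QCAlgebra.Iso.assoc _ _ _).trans
        (((QCAlgebra.Iso.refl D).tensor (.comm _ _)).trans (.symm (.assoc _ _ _)))
    exact ⟨E, F, hE, hF, ⟨(swap _ _).trans ((e.tensor (.refl _)).trans (swap _ _).symm)⟩⟩

theorem BrauerEquiv.tensor {A B A' B' : Azumaya S} (h : BrauerEquiv A B) (h' : BrauerEquiv A' B') :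
    BrauerEquiv (A.tensor A') (B.tensor B') :=
  (h.tensor_right A').trans ((of_iso (A := B.tensor A') (B := A'.tensor B) (.comm _ _)).trans
    ((h'.tensor_right B).trans (of_iso (A := B'.tensor B) (B := B.tensor B') (.comm _ _))))

theorem BrauerEquiv.pullback {A B : Azumaya S} (f : T ⟶ S) :
    BrauerEquiv A B → BrauerEquiv (A.pullback f) (B.pullback f) :=
  fun ⟨E, F, hE, hF, ⟨e⟩⟩ =>
    ⟨E.pullback f, F.pullback f, hE.pullback f, hF.pullback f, ⟨e.pullback f⟩⟩

theorem BrauerEquiv.tensor_op (A : Azumaya S) : BrauerEquiv (A.tensor A.op) (trivial S) :=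
  ⟨.unit S, A.toLocFree, LocFree.isPositive_unit S, A.isPositive_toLocFree,
    ⟨(A.tensorOp.tensor (QCAlgebra.Iso.unitEnd S).symm).trans (.comm _ _)⟩⟩

/-- Brauer equivalence as a setoid. -/
abbrev setoid (S : Scheme.{u}) : Setoid (Azumaya S) where
  r := BrauerEquiv
  iseqv := ⟨fun _ => .of_iso (.refl _), .symm, .trans⟩

end Azumaya

/-- The Brauer group of a scheme: Azumaya algebras modulo Brauer equivalence. -/
def Br (S : Scheme.{u}) : Type (u + 1) := Quotient (Azumaya.setoid S)

namespace Br

variable {S T : Scheme.{u}}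

/-- The Brauer class of an Azumaya algebra. -/
def mk (A : Azumaya S) : Br S := Quotient.mk (Azumaya.setoid S) A

/-- The group law is induced by the tensor product; the inverse by the opposite algebra. -/
instance : CommGroup (Br S) where
  mul := Quotient.map₂ Azumaya.tensor fun _ _ h _ _ h' => h.tensor h'
  one := mk (.trivial S)
  mul_comm := by
    rintro ⟨A⟩ ⟨B⟩
    exact Quotient.sound (.of_iso (.comm _ _))
  mul_assoc := by
    rintro ⟨A⟩ ⟨B⟩ ⟨C⟩
    exact Quotient.sound (.of_iso (.assoc _ _ _))
  mul_one := by
    rintro ⟨A⟩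
    exact Quotient.sound (.of_iso (.tensorUnit _))
  one_mul := by
    rintro ⟨A⟩
    exact Quotient.sound (.of_iso (.trans (.comm _ _) (.tensorUnit _)))
  inv := Quotient.map Azumaya.op fun A B h => by
    have h₁ : Azumaya.BrauerEquiv (A.op.tensor (B.tensor B.op)) A.op :=
      ((Azumaya.BrauerEquiv.of_iso (.refl _)).tensor (.tensor_op B)).trans (.of_iso (.tensorUnit _))
    have h₂ : Azumaya.BrauerEquiv (A.op.tensor (A.tensor B.op)) B.op :=
      (Azumaya.BrauerEquiv.of_iso (.trans (.symm (.assoc _ _ _)) (.comm _ _))).trans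
        (((Azumaya.BrauerEquiv.of_iso (A := B.op) (.refl _)).tensor
          (.trans (.of_iso (A := A.op.tensor A) (B := A.tensor A.op)
            (.comm A.op.toQCAlgebra A.toQCAlgebra)) (.tensor_op A))).trans (.of_iso (.tensorUnit _)))
    exact h₁.symm.trans (((Azumaya.BrauerEquiv.of_iso (.refl _)).tensor
      (h.symm.tensor_right B.op)).trans h₂)
  inv_mul_cancel := by
    rintro ⟨A⟩
    exact Quotient.sound (.trans (.of_iso (A := A.op.tensor A) (B := A.tensor A.op)
      (.comm A.op.toQCAlgebra A.toQCAlgebra)) (.tensor_op A))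

/-- The homomorphism `Br(S) → Br(T)` induced by `f : T ⟶ S`. -/
def map (f : T ⟶ S) : Br S →* Br T where
  toFun := Quotient.map (Azumaya.pullback f) fun _ _ h => h.pullback f
  map_one' := Quotient.sound (.of_iso (.refl _))
  map_mul' := by
    rintro ⟨A⟩ ⟨B⟩
    exact Quotient.sound (.of_iso (.refl _))

end Br

/-! ### Projective space, Brauer–Severi schemes and their classes -/

attribute [local instance] MvPolynomial.gradedAlgebra

/-- The projective space `ℙ(n; ℤ)` over the integers. -/
def projZ (n : ℕ) : Scheme.{u} :=
  Proj (MvPolynomial.homogeneousSubmodule (Fin (n + 1)) (ULift.{u} ℤ))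

/-- The projective space of relative dimension `n` over `S`, as an `S`-scheme. -/
def projSpace (n : ℕ) (S : Scheme.{u}) : Over S :=
  Over.mk (pullback.fst (terminal.from S) (terminal.from (projZ.{u} n)))

/-- A morphism of finite type. -/
def FiniteType {X Y : Scheme.{u}} (f : X ⟶ Y) : Prop := LocallyOfFiniteType f ∧ QuasiCompact f

/-- A Brauer–Severi scheme of relative dimension `n` over `S`: an `S`-scheme which is isomorphic
to the projective space of relative dimension `n` locally in the étale topology of `S`. -/
def IsBrauerSeveri {S : Scheme.{u}} (n : ℕ) (P : Over S) : Prop :=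
  ∃ (U : Scheme.{u}) (f : U ⟶ S), Etale f ∧ Surjective f ∧
    Nonempty ((Over.pullback f).obj P ≅ projSpace n U)

theorem FiniteType.comp {X Y Z : Scheme.{u}} {f : X ⟶ Y} {g : Y ⟶ Z} (hf : FiniteType f)
    (hg : FiniteType g) : FiniteType (f ≫ g) := by
  have := hf.1; have := hf.2; have := hg.1; have := hg.2
  exact ⟨inferInstance, inferInstance⟩

theorem FiniteType.of_isClosedImmersion {X Y : Scheme.{u}} (f : X ⟶ Y) [IsClosedImmersion f] :
    FiniteType f :=
  ⟨inferInstance, inferInstance⟩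

theorem FiniteType.fst {X Y Z : Scheme.{u}} (f : X ⟶ Z) {g : Y ⟶ Z} (hg : FiniteType g) :
    FiniteType (pullback.fst f g) := by
  have := hg.1; have := hg.2
  exact ⟨inferInstance, inferInstance⟩

theorem finiteType_projZ (n : ℕ) : FiniteType (terminal.from (projZ.{u} n)) := by
  let 𝒜 := MvPolynomial.homogeneousSubmodule (Fin (n + 1)) (ULift.{u} ℤ)
  let φ : ULift.{u} ℤ →+* 𝒜 0 := algebraMap _ _
  have hφ : Function.Surjective φ := by
    rintro ⟨p, hp⟩
    have hp' : p.IsHomogeneous 0 := hp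
    refine ⟨MvPolynomial.coeff 0 p, Subtype.ext ?_⟩
    exact (MvPolynomial.totalDegree_eq_zero_iff_eq_C.mp
      (Nat.le_zero.mp hp'.totalDegree_le)).symm
  have h₀ : Algebra.FiniteType (𝒜 0) (MvPolynomial (Fin (n + 1)) (ULift.{u} ℤ)) := by
    refine ⟨Finset.univ.image MvPolynomial.X, ?_⟩
    rw [eq_top_iff]
    rintro p -
    induction p using MvPolynomial.induction_on with
    | C a => exact Subalgebra.algebraMap_mem _ (φ a)
    | add p q hp hq => exact add_mem hp hq
    | mul_X p i hp => exact mul_mem hp (Algebra.subset_adjoin (by simp))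
  let f : projZ.{u} n ⟶ Spec (.of (𝒜 0)) := Proj.toSpecZero 𝒜
  have hf : FiniteType f := ⟨inferInstanceAs (LocallyOfFiniteType (Proj.toSpecZero 𝒜)),
    inferInstanceAs (QuasiCompact (Proj.toSpecZero 𝒜))⟩
  let ψ : CommRingCat.of (ULift.{u} ℤ) ⟶ CommRingCat.of (𝒜 0) := CommRingCat.ofHom φ
  have hg : IsClosedImmersion (Spec.map ψ) := IsClosedImmersion.spec_of_surjective ψ hφ
  have := isIso_of_isTerminal specULiftZIsTerminal.{u} terminalIsTerminal (terminal.from _)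
  have h : terminal.from (projZ.{u} n) = f ≫ Spec.map ψ ≫
      terminal.from (Spec (.of (ULift.{u} ℤ))) := Subsingleton.elim _ _
  rw [h]
  exact hf.comp ((FiniteType.of_isClosedImmersion _).comp (.of_isClosedImmersion _))

theorem finiteType_projSpace (n : ℕ) (S : Scheme.{u}) : FiniteType (projSpace n S).hom :=
  .fst _ (finiteType_projZ n)

theorem quasiCompact_of_pullback {X Y Z : Scheme.{u}} (f : X ⟶ Z) (g : Y ⟶ Z) [Etale f]
    [Surjective f] (h : QuasiCompact (pullback.fst f g)) : QuasiCompact g := by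
  refine ⟨fun V hV hVc => ?_⟩
  obtain ⟨W, hW, hWV⟩ := f.isOpenMap.exists_opens_image_eq_of_prespectralSpace
    f.continuous (by rw [Set.range_eq_univ.mpr f.surjective]; exact Set.subset_univ V) hV hVc
  have hc : IsCompact ((pullback.fst f g) ⁻¹' (W : Set X)) :=
    h.isCompact_preimage W W.2 hW
  rw [← hWV, ← Scheme.image_preimage_eq_of_isPullback (IsPullback.of_hasPullback f g)]
  exact hc.image (pullback.snd f g).continuous

theorem locallyOfFiniteType_of_pullback {X Y Z : Scheme.{u}} (f : X ⟶ Z) (g : Y ⟶ Z) [Etale f]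
    [Surjective f] (h : LocallyOfFiniteType (pullback.fst f g)) : LocallyOfFiniteType g := by
  have h₁ := @HasRingHomProperty.instIsZariskiLocalAtTarget.{u} (@LocallyOfFiniteType) _
    instHasRingHomPropertyLocallyOfFiniteTypeFiniteType
  have h₂ := @instDescendsAlongSchemeMinMorphismPropertySurjectiveFlatLocallyOfFinitePresentationOfQuasiCompactOfIsZariskiLocalAtTarget.{u} (@LocallyOfFiniteType) inferInstance h₁
  exact h₂.of_isPullback (IsPullback.of_hasPullback f g) ⟨⟨inferInstance, inferInstance⟩, inferInstance⟩ h

theorem IsBrauerSeveri.finiteType {S : Scheme.{u}} {n : ℕ} {P : Over S}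
    (hP : IsBrauerSeveri n P) : FiniteType P.hom := by
  obtain ⟨U, f, hf, hf', ⟨e⟩⟩ := hP
  have h : FiniteType (pullback.fst f P.hom) := by
    let i : pullback f P.hom ≅ (projSpace n U).left :=
      pullbackSymmetry f P.hom ≪≫ (Over.forget U).mapIso e
    have h : pullback.fst f P.hom = i.hom ≫ (projSpace n U).hom := by
      have : ((Over.pullback f).obj P).hom = e.hom.left ≫ (projSpace n U).hom :=
        (Over.w e.hom).symm
      rw [← pullbackSymmetry_hom_comp_snd]
      exact (congrArg ((pullbackSymmetry f P.hom).hom ≫ ·) this).trans (Category.assoc _ _ _).symm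
    rw [h]
    exact FiniteType.comp (.of_isClosedImmersion _) (finiteType_projSpace n U)
  exact ⟨locallyOfFiniteType_of_pullback f _ h.1, quasiCompact_of_pullback f _ h.2⟩

/-- `I` is a point of the Brauer–Severi scheme of the Azumaya algebra `A` of degree `n + 1` over
the ring `R`: it is a left ideal of `A`, a direct summand as an `R`-module, of rank `n + 1`.
For `A = End(V)` these are the `φ` vanishing on the kernel of a rank one quotient of `V`, so that
the Brauer–Severi scheme of `End(V)` is the bundle `Proj(Sym V)`. -/
def IsBrauerSeveriPoint (n : ℕ) {R A : Type u} [CommRing R] [Ring A] [Algebra R A]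
    (I : Ideal A) : Prop :=
  Module.Projective R (A ⧸ I.restrictScalars R) ∧
    ∀ p : PrimeSpectrum R, Module.rankAtStalk (R := R) (I.restrictScalars R) p = n + 1

/-- The `S`-scheme `P` is the Brauer–Severi scheme of the Azumaya algebra `A`, which is of degree
`n + 1`: it represents the functor which sends an affine scheme `Spec R` over `S` to the set of
left ideals of `A_R` that are direct summands of rank `n + 1`. -/
structure BrauerSeveriOf {S : Scheme.{u}} (n : ℕ) (A : Azumaya S) (P : Over S) where
  degree : ∀ (R : Type u) [CommRing R] (x : Spec (.of R) ⟶ S) (p : PrimeSpectrum R),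
    Module.rankAtStalk (A.obj R x) p = (n + 1) ^ 2
  equiv : ∀ (R : Type u) [CommRing R] (x : Spec (.of R) ⟶ S),
    {s : Spec (.of R) ⟶ P.left // s ≫ P.hom = x} ≃
      {I : Ideal (A.obj R x) // IsBrauerSeveriPoint (R := R) n I}
  naturality : ∀ {R R' : Type u} [CommRing R] [CommRing R'] [Algebra R R']
    {x : Spec (.of R) ⟶ S} {y : Spec (.of R') ⟶ S} (h : Restricts x y)
    (s : {s : Spec (.of R) ⟶ P.left // s ≫ P.hom = x})
    (t : {t : Spec (.of R') ⟶ P.left // t ≫ P.hom = y}),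
    t.1 = Spec.map (CommRingCat.ofHom (algebraMap R R')) ≫ s.1 →
      (equiv R' y t).1 = Ideal.span (A.res h '' (equiv R x s).1)

/-- `β ∈ Br(S)` is the class of the Brauer–Severi scheme `P` of relative dimension `n`: it is the
class of the Azumaya algebra of degree `n + 1` whose Brauer–Severi scheme is `P`. -/
def IsBrauerClass {S : Scheme.{u}} (n : ℕ) (P : Over S) (β : Br S) : Prop :=
  ∃ A : Azumaya S, Nonempty (BrauerSeveriOf n A P) ∧ Br.mk A = β

/-! ### The Grothendieck ring of schemes of finite type -/

theorem isReduced_nilradical_subscheme (X : Scheme.{u}) :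
    AlgebraicGeometry.IsReduced X.nilradical.subscheme := by
  have h (i) : AlgebraicGeometry.IsReduced (X.nilradical.subschemeCover.openCover.X i) := by
    let U : X.affineOpens := i
    change AlgebraicGeometry.IsReduced
      (Spec (.of ((X.presheaf.obj (.op U.1)) ⧸ X.nilradical.ideal U)))
    rw [affine_isReduced_iff]
    exact (Ideal.isRadical_iff_quotient_reduced _).mp (Ideal.radical_isRadical _)
  exact AlgebraicGeometry.IsReduced.of_openCover _ X.nilradical.subschemeCover.openCover

/-- A reduced scheme of finite type over `S`. -/
structure RedFT (S : Scheme.{u}) where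
  obj : Over S
  isReduced : AlgebraicGeometry.IsReduced obj.left
  finiteType : FiniteType obj.hom

/-- Two reduced schemes of finite type over `S` are identified if they are isomorphic over `S`. -/
abbrev isoSetoid (S : Scheme.{u}) : Setoid (RedFT S) where
  r X Y := Nonempty (X.obj ≅ Y.obj)
  iseqv := ⟨fun _ => ⟨Iso.refl _⟩, fun ⟨e⟩ => ⟨e.symm⟩, fun ⟨e⟩ ⟨f⟩ => ⟨e.trans f⟩⟩

/-- The free abelian group on the isomorphism classes of reduced schemes of finite type. -/
abbrev FreeIso (S : Scheme.{u}) : Type (u + 1) := FreeAbelianGroup (Quotient (isoSetoid S))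

/-- The generator of the free abelian group given by a reduced scheme of finite type. -/
def gen {S : Scheme.{u}} (X : RedFT S) : FreeIso S :=
  FreeAbelianGroup.of (Quotient.mk (isoSetoid S) X)

/-- The relations `[X] = [U] + [Z]`, where `U` is an open subscheme of `X` and `Z` is the
complement of `U` with its reduced structure. -/
def scissors (S : Scheme.{u}) : Set (FreeIso S) :=
  {r | ∃ (X U Z : RedFT S) (j : U.obj ⟶ X.obj) (i : Z.obj ⟶ X.obj),
    IsOpenImmersion j.left ∧ IsClosedImmersion i.left ∧
    Set.range i.left = (Set.range j.left)ᶜ ∧ r = gen X - (gen U + gen Z)}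

/-- (The additive group of) the Grothendieck ring `M(S)` of schemes of finite type over `S`. -/
def M (S : Scheme.{u}) : Type (u + 1) := FreeIso S ⧸ AddSubgroup.closure (scissors S)

instance (S : Scheme.{u}) : AddCommGroup (M S) :=
  inferInstanceAs (AddCommGroup (FreeIso S ⧸ AddSubgroup.closure (scissors S)))

/-- The reduced scheme underlying an `S`-scheme of finite type. -/
def red {S : Scheme.{u}} (X : Over S) (hX : FiniteType X.hom) : RedFT S where
  obj := Over.mk (X.left.nilradical.subschemeι ≫ X.hom)
  isReduced := isReduced_nilradical_subscheme X.left
  finiteType := (FiniteType.of_isClosedImmersion _).comp hX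

/-- The class `[X]` in `M(S)` of an `S`-scheme `X` of finite type: the class of `X` with its
reduced structure. -/
def cls {S : Scheme.{u}} (X : Over S) (hX : FiniteType X.hom) : M S :=
  QuotientAddGroup.mk (gen (red X hX))

/-- The fibre product `X × Y` over `S`, as an `S`-scheme. -/
def fiberProd {S : Scheme.{u}} (X Y : Over S) : Over S := Over.mk (pullback.fst X.hom Y.hom ≫ X.hom)

theorem finiteType_fiberProd {S : Scheme.{u}} {X Y : Over S} (hX : FiniteType X.hom)
    (hY : FiniteType Y.hom) : FiniteType (fiberProd X Y).hom :=
  (FiniteType.fst _ hY).comp hX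

/-- The projective space of relative dimension `n` over an `S`-scheme `X`, as an `S`-scheme. -/
def projSpaceOver {S : Scheme.{u}} (n : ℕ) (X : Over S) : Over S :=
  Over.mk ((projSpace n X.left).hom ≫ X.hom)

theorem finiteType_projSpaceOver {S : Scheme.{u}} (n : ℕ) {X : Over S} (hX : FiniteType X.hom) :
    FiniteType (projSpaceOver n X).hom :=
  (finiteType_projSpace n X.left).comp hX

end

end BrauerSeveri

/-!
Let `A` be the Azumaya algebra of degree `n + 1` on `S` whose Brauer–Severi scheme is `P`. The
projections of `X × P` and of `ℙⁿ_X` to `X` are isomorphic Zariski locally on `X`, and this suffices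
for the equality of classes.

*Triviality of the class.* On `X` one has `A ⊗ End(E) ≅ End(F)` with `E` of positive rank. Where `E`
is free, a rank one idempotent of `End(E)` corresponds to an idempotent `q` of `End(F)`, whose
corners are `A` and `End(q F)`; so `A ≅ End(q F)` (`exists_algEquiv_end`). Where `q F` is free too,
`A` is a matrix algebra, of size `n + 1` by the rank of `A` (`exists_algEquiv_matrix`).

*The Brauer–Severi scheme of a matrix algebra.* A row vector `l` over `B` with a coordinate `1`
defines a point of `ℙⁿ` over `B`, and also a left ideal of the matrix ring over `B`, namely that of
the matrices all of whose rows are multiples of `l`. Locally every affine point of either side arises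
in this way: for the left ideals, some row of a matrix in the ideal is nonzero at a given prime, and
the ideal of that row is the whole left ideal by comparison of ranks
(`IsBrauerSeveriPoint.eq_rowIdeal`). On both sides two row vectors define the same point if and only if the `2 × 2` minors vanish
(`rowPoint_eq_iff`, `coordPoint_eq_iff`). Two schemes that receive the same family of morphisms, with
local sections and the same identifications, are isomorphic (`exists_iso_of_hasLocalSections`), whence
`exists_iso_projSpace`.

*Scissor relations.* Finitely many opens of `X` on which the two projections are isomorphic cover `X`.
Cutting `X` into one of them and its closed complement, and repeating this on the complement, the two
classes agree piece by piece; the local isomorphisms need not glue (`cls_eq_of_locally_iso`).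
-/

namespace BrauerSeveri

noncomputable section

/-! ### Classes in the Grothendieck ring -/

instance surjective_nilradical_subschemeι (X : Scheme.{u}) :
    Surjective X.nilradical.subschemeι := by
  refine ⟨Set.range_eq_univ.mp ?_⟩
  rw [Scheme.IdealSheafData.range_subschemeι, Scheme.nilradical,
    Scheme.IdealSheafData.support_radical, Scheme.IdealSheafData.support_bot]
  rfl

section GrothendieckRing

variable {S : Scheme.{u}}

/-- The class of `Y` is that of any reduced scheme with a surjective closed immersion into `Y`, since
such a scheme is isomorphic to the reduction of `Y`. -/
theorem cls_eq_mk_gen {Y : Over S} (hY : FiniteType Y.hom) (W : RedFT S) (i : W.obj ⟶ Y)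
    [IsClosedImmersion i.left] [Surjective i.left] :
    cls Y hY = QuotientAddGroup.mk (gen W) := by
  let ι := Y.left.nilradical.subschemeι
  have := W.isReduced
  have := isReduced_nilradical_subscheme Y.left
  have h₁ : IsIso (pullback.fst i.left ι) := isIso_of_isClosedImmersion_of_surjective _
  have h₂ : IsIso (pullback.snd i.left ι) := isIso_of_isClosedImmersion_of_surjective _
  refine congrArg QuotientAddGroup.mk (congrArg FreeAbelianGroup.of (Quotient.sound ⟨?_⟩))
  refine Over.isoMk ((asIso (pullback.snd i.left ι)).symm ≪≫ asIso (pullback.fst i.left ι)) ?_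
  have hw : i.left ≫ Y.hom = W.obj.hom := Over.w i
  change (inv (pullback.snd i.left ι) ≫ pullback.fst i.left ι) ≫ W.obj.hom = ι ≫ Y.hom
  rw [← hw, Category.assoc, pullback.condition_assoc, IsIso.inv_hom_id_assoc]

/-- The canonical closed immersion of the reduction. -/
def redHom (Y : Over S) (hY : FiniteType Y.hom) : (red Y hY).obj ⟶ Y :=
  Over.homMk Y.left.nilradical.subschemeι rfl

theorem cls_congr {Y Y' : Over S} (hY : FiniteType Y.hom) (hY' : FiniteType Y'.hom)
    (e : Y ≅ Y') : cls Y hY = cls Y' hY' := by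
  have he : IsIso e.hom.left := inferInstanceAs (IsIso ((Over.forget S).map e.hom))
  have h₁ : IsClosedImmersion (redHom Y hY ≫ e.hom).left :=
    inferInstanceAs (IsClosedImmersion (Y.left.nilradical.subschemeι ≫ e.hom.left))
  have h₂ : Surjective (redHom Y hY ≫ e.hom).left :=
    inferInstanceAs (Surjective (Y.left.nilradical.subschemeι ≫ e.hom.left))
  exact (cls_eq_mk_gen hY' (red Y hY) (redHom Y hY ≫ e.hom)).symm

/-- The scissor relation for schemes which need not be reduced. -/
theorem cls_eq_add {Y U Z : Over S} (hY : FiniteType Y.hom) (hU : FiniteType U.hom)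
    (hZ : FiniteType Z.hom) (j : U ⟶ Y) (i : Z ⟶ Y) [IsOpenImmersion j.left]
    [IsClosedImmersion i.left] (h : Set.range i.left = (Set.range j.left)ᶜ) :
    cls Y hY = cls U hU + cls Z hZ := by
  let ι := Y.left.nilradical.subschemeι
  have := isReduced_nilradical_subscheme Y.left
  have hw : i.left ≫ Y.hom = Z.hom := Over.w i
  have hw' : j.left ≫ Y.hom = U.hom := Over.w j
  -- the reduced structure on `U` as an open subscheme of the reduction of `Y`
  have hr : AlgebraicGeometry.IsReduced (pullback j.left ι) :=
    isReduced_of_isOpenImmersion (pullback.snd j.left ι)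
  let U' : RedFT S := ⟨Over.mk (pullback.fst j.left ι ≫ U.hom), hr,
    (FiniteType.of_isClosedImmersion _).comp hU⟩
  let u : U'.obj ⟶ U := Over.homMk (pullback.fst j.left ι) rfl
  have hu₁ : IsClosedImmersion u.left := inferInstanceAs (IsClosedImmersion (pullback.fst j.left ι))
  have hu₂ : Surjective u.left := inferInstanceAs (Surjective (pullback.fst j.left ι))
  let W : Over S := Over.mk (pullback.fst i.left ι ≫ Z.hom)
  have hW : FiniteType W.hom := (FiniteType.of_isClosedImmersion _).comp hZ
  let Z' : RedFT S := red W hW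
  let z : Z'.obj ⟶ Z := Over.homMk (W.left.nilradical.subschemeι ≫ pullback.fst i.left ι) (by
    exact Category.assoc _ _ _)
  have hz₁ : IsClosedImmersion z.left :=
    inferInstanceAs (IsClosedImmersion (W.left.nilradical.subschemeι ≫ pullback.fst i.left ι))
  have hz₂ : Surjective z.left :=
    inferInstanceAs (Surjective (W.left.nilradical.subschemeι ≫ pullback.fst i.left ι))
  rw [cls_eq_mk_gen hU U' u, cls_eq_mk_gen hZ Z' z]
  have hj : U'.obj.hom = pullback.snd j.left ι ≫ (red Y hY).obj.hom := by
    change pullback.fst j.left ι ≫ U.hom = pullback.snd j.left ι ≫ ι ≫ Y.hom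
    rw [← hw', pullback.condition_assoc]
  have hi : Z'.obj.hom =
      (W.left.nilradical.subschemeι ≫ pullback.snd i.left ι) ≫ (red Y hY).obj.hom := by
    change W.left.nilradical.subschemeι ≫ pullback.fst i.left ι ≫ Z.hom =
      (W.left.nilradical.subschemeι ≫ pullback.snd i.left ι) ≫ ι ≫ Y.hom
    rw [← hw, pullback.condition_assoc, Category.assoc]
  have hmem : gen (red Y hY) - (gen U' + gen Z') ∈ scissors S := by
    refine ⟨red Y hY, U', Z', Over.homMk (pullback.snd j.left ι) hj.symm,
      Over.homMk (W.left.nilradical.subschemeι ≫ pullback.snd i.left ι) hi.symm, ?_, ?_, ?_, rfl⟩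
    · exact inferInstanceAs (IsOpenImmersion (pullback.snd j.left ι))
    · exact inferInstanceAs (IsClosedImmersion
        (W.left.nilradical.subschemeι ≫ pullback.snd i.left ι))
    · change Set.range (W.left.nilradical.subschemeι ≫ pullback.snd i.left ι) =
        (Set.range (pullback.snd j.left ι))ᶜ
      rw [Scheme.Hom.comp_base, TopCat.coe_comp, Set.range_comp,
        Set.range_eq_univ.mpr W.left.nilradical.subschemeι.surjective, Set.image_univ]
      change Set.range (pullback.snd i.left ι) = _
      rw [Scheme.Pullback.range_snd, Scheme.Pullback.range_snd, h, Set.preimage_compl]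
  have := (QuotientAddGroup.eq_zero_iff _).mpr (AddSubgroup.subset_closure hmem)
  exact sub_eq_zero.mp this

theorem exists_isClosedImmersion_range_eq (X : Scheme.{u}) (Z : Set X) (hZ : IsClosed Z) :
    ∃ (W : Scheme.{u}) (i : W ⟶ X), IsClosedImmersion i ∧ Set.range i = Z :=
  ⟨_, (Scheme.IdealSheafData.vanishingIdeal ⟨Z, hZ⟩).subschemeι, inferInstance, by
    rw [Scheme.IdealSheafData.range_subschemeι]
    simp⟩

/-- Two `X`-schemes which become isomorphic along `u` become isomorphic along every morphism that
factors through `u`. -/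
theorem exists_iso_pullback_comp {X Y Y' V Z : Scheme.{u}} (f : Y ⟶ X) (f' : Y' ⟶ X) (u : V ⟶ X)
    (e : pullback u f ≅ pullback u f') (he : e.hom ≫ pullback.fst u f' = pullback.fst u f)
    (z : Z ⟶ V) (w : Z ⟶ X) (hw : w = z ≫ u) :
    ∃ e' : pullback w f ≅ pullback w f', e'.hom ≫ pullback.fst w f' = pullback.fst w f := by
  subst hw
  let i₁ := pullbackRightPullbackFstIso u f z
  let i₂ := pullbackRightPullbackFstIso u f' z
  let m : pullback z (pullback.fst u f) ≅ pullback z (pullback.fst u f') :=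
    asIso (pullback.map _ _ _ _ (𝟙 Z) e.hom (𝟙 V) (by simp) (by simp [he]))
  refine ⟨i₁.symm ≪≫ m ≪≫ i₂, ?_⟩
  have hm : m.hom ≫ pullback.fst z (pullback.fst u f') = pullback.fst z (pullback.fst u f) :=
    (pullback.lift_fst _ _ _).trans (Category.comp_id _)
  simp [i₁, i₂, hm]

theorem finiteType_pullback_over {X Y : Scheme.{u}} {f : Y ⟶ X} (hf : FiniteType f) {Z : Over S}
    (hZ : FiniteType Z.hom) (z : Z.left ⟶ X) :
    FiniteType (Over.mk (pullback.fst z f ≫ Z.hom)).hom :=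
  (FiniteType.fst _ hf).comp hZ

/-- The scissor relation on `Z`, pulled back along a morphism of finite type. -/
theorem cls_pullback_eq_add {X T : Scheme.{u}} {g : T ⟶ X} (hg : FiniteType g) {Z ZU ZW : Over S}
    (hZ : FiniteType Z.hom) (hZU : FiniteType ZU.hom) (hZW : FiniteType ZW.hom)
    (z : Z.left ⟶ X) (j : ZU ⟶ Z) (i : ZW ⟶ Z) [IsOpenImmersion j.left]
    [IsClosedImmersion i.left] (h : Set.range i.left = (Set.range j.left)ᶜ) :
    cls (Over.mk (pullback.fst z g ≫ Z.hom)) (finiteType_pullback_over hg hZ z) =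
      cls (Over.mk (pullback.fst (j.left ≫ z) g ≫ ZU.hom))
          (finiteType_pullback_over hg hZU (j.left ≫ z)) +
        cls (Over.mk (pullback.fst (i.left ≫ z) g ≫ ZW.hom))
          (finiteType_pullback_over hg hZW (i.left ≫ z)) := by
  have aux {Q : Over S} (hQ : FiniteType Q.hom) (q : Q ⟶ Z) :
      cls (Over.mk (pullback.fst (q.left ≫ z) g ≫ Q.hom))
          (finiteType_pullback_over hg hQ (q.left ≫ z)) =
        cls (Over.mk (pullback.fst q.left (pullback.fst z g) ≫ Q.hom))
          (finiteType_pullback_over (FiniteType.fst z hg) hQ q.left) :=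
    cls_congr _ _ (Over.isoMk (pullbackRightPullbackFstIso z g q.left).symm (by simp))
  rw [aux hZU j, aux hZW i]
  have hj : j.left ≫ Z.hom = ZU.hom := Over.w j
  have hi : i.left ≫ Z.hom = ZW.hom := Over.w i
  refine @cls_eq_add _ _ _ _ _ _ _ (Over.homMk (pullback.snd j.left (pullback.fst z g)) ?_)
    (Over.homMk (pullback.snd i.left (pullback.fst z g)) ?_) ?_ ?_ ?_
  · change pullback.snd j.left (pullback.fst z g) ≫ pullback.fst z g ≫ Z.hom = _ ≫ ZU.hom
    rw [← hj, pullback.condition_assoc]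
  · change pullback.snd i.left (pullback.fst z g) ≫ pullback.fst z g ≫ Z.hom = _ ≫ ZW.hom
    rw [← hi, pullback.condition_assoc]
  · exact inferInstanceAs (IsOpenImmersion (pullback.snd j.left (pullback.fst z g)))
  · exact inferInstanceAs (IsClosedImmersion (pullback.snd i.left (pullback.fst z g)))
  · change Set.range (pullback.snd i.left (pullback.fst z g)) =
      (Set.range (pullback.snd j.left (pullback.fst z g)))ᶜ
    rw [Scheme.Pullback.range_snd, Scheme.Pullback.range_snd, h, Set.preimage_compl]

/-- If `f` and `f'` become isomorphic along each of the open immersions `v k`, then so do, up to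
scissor relations, their pullbacks to a scheme `Z` covered by finitely many of the `V k`. The
induction cuts `Z` into the preimage of one `V k` and its closed complement, which the remaining
ones cover; the isomorphisms need not agree on overlaps. -/
theorem cls_pullback_eq_of_subset_iUnion [IsLocallyNoetherian S] {X Y Y' : Scheme.{u}}
    {f : Y ⟶ X} {f' : Y' ⟶ X} (hf : FiniteType f) (hf' : FiniteType f') {ι : Type*}
    (V : ι → Scheme.{u}) (v : ∀ k, V k ⟶ X) [∀ k, IsOpenImmersion (v k)]
    (e : ∀ k, pullback (v k) f ≅ pullback (v k) f')
    (he : ∀ k, (e k).hom ≫ pullback.fst (v k) f' = pullback.fst (v k) f) (s : Finset ι) :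
    ∀ (Z : Over S) (hZ : FiniteType Z.hom) (z : Z.left ⟶ X),
      Set.range z ⊆ ⋃ k ∈ s, Set.range (v k) →
      cls (Over.mk (pullback.fst z f ≫ Z.hom)) (finiteType_pullback_over hf hZ z) =
        cls (Over.mk (pullback.fst z f' ≫ Z.hom)) (finiteType_pullback_over hf' hZ z) := by
  classical
  induction s using Finset.induction_on with
  | empty =>
    intro Z hZ z hz
    have hZe : IsEmpty Z.left := ⟨fun x => by simpa using hz ⟨x, rfl⟩⟩
    have h₁ : IsEmpty (pullback z f : Scheme) := Function.isEmpty (pullback.fst z f)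
    have h₂ : IsEmpty (pullback z f' : Scheme) := Function.isEmpty (pullback.fst z f')
    have t₁ := isInitialOfIsEmpty (X := pullback z f)
    have t₂ := isInitialOfIsEmpty (X := pullback z f')
    exact cls_congr _ _ (Over.isoMk (t₁.uniqueUpToIso t₂) (t₁.hom_ext _ _))
  | insert k s hk ih =>
    intro Z hZ z hz
    let j : pullback z (v k) ⟶ Z.left := pullback.fst z (v k)
    obtain ⟨W, i, hi, hr⟩ := exists_isClosedImmersion_range_eq Z.left (Set.range j)ᶜ
      j.isOpenEmbedding.isOpen_range.isClosed_compl
    -- The noetherian hypothesis makes the open immersion `j` quasi-compact, hence of finite type.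
    have := hZ.1
    have : IsLocallyNoetherian Z.left := LocallyOfFiniteType.isLocallyNoetherian Z.hom
    have hj : FiniteType j := ⟨inferInstance, inferInstance⟩
    let ZU : Over S := Over.mk (j ≫ Z.hom)
    have hZU : FiniteType ZU.hom := hj.comp hZ
    let ZW : Over S := Over.mk (i ≫ Z.hom)
    have hZW : FiniteType ZW.hom := (FiniteType.of_isClosedImmersion i).comp hZ
    let jU : ZU ⟶ Z := Over.homMk j rfl
    let iW : ZW ⟶ Z := Over.homMk i rfl
    have hjU : IsOpenImmersion jU.left := inferInstanceAs (IsOpenImmersion j)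
    have hiW : IsClosedImmersion iW.left := hi
    rw [cls_pullback_eq_add hf hZ hZU hZW z jU iW hr, cls_pullback_eq_add hf' hZ hZU hZW z jU iW hr]
    congr 1
    · have hz' : jU.left ≫ z = pullback.snd z (v k) ≫ v k := pullback.condition
      obtain ⟨e', he'⟩ := exists_iso_pullback_comp f f' (v k) (e k) (he k) (pullback.snd z (v k)) _ hz'
      exact cls_congr _ _ (Over.isoMk e' (by simp [reassoc_of% he']))
    · refine ih ZW hZW (iW.left ≫ z) ?_
      rintro _ ⟨x, rfl⟩
      have hx : i x ∉ Set.range j := by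
        have : i x ∈ (Set.range j)ᶜ := hr ▸ ⟨x, rfl⟩
        exact this
      rw [Scheme.Pullback.range_fst] at hx
      have := hz ⟨i x, rfl⟩
      rw [Finset.set_biUnion_insert] at this
      exact this.resolve_left hx

/-- Schemes of finite type over `X` which are isomorphic Zariski locally on `X` have the same class. -/
theorem cls_eq_of_locally_iso [IsNoetherian S] {X : Over S} (hX : FiniteType X.hom)
    {Y Y' : Scheme.{u}} {f : Y ⟶ X.left} {f' : Y' ⟶ X.left} (hf : FiniteType f)
    (hf' : FiniteType f')
    (H : ∀ x : X.left, ∃ (V : Scheme.{u}) (v : V ⟶ X.left), IsOpenImmersion v ∧ x ∈ Set.range v ∧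
      ∃ e : pullback v f ≅ pullback v f', e.hom ≫ pullback.fst v f' = pullback.fst v f) :
    cls (Over.mk (f ≫ X.hom)) (hf.comp hX) = cls (Over.mk (f' ≫ X.hom)) (hf'.comp hX) := by
  choose V v hv hxv e he using H
  have := hX.2
  have : CompactSpace X.left := QuasiCompact.compactSpace_of_compactSpace X.hom
  obtain ⟨s, hs⟩ := isCompact_univ.elim_finite_subcover (fun x => Set.range (v x))
    (fun x => (v x).isOpenEmbedding.isOpen_range) (fun x _ => Set.mem_iUnion.mpr ⟨x, hxv x⟩)
  have key := cls_pullback_eq_of_subset_iUnion hf hf' V v e he s X hX (𝟙 _)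
    ((Set.subset_univ _).trans hs)
  have aux {T : Scheme.{u}} {g : T ⟶ X.left} (hg : FiniteType g) :
      cls (Over.mk (g ≫ X.hom)) (hg.comp hX) =
        cls (Over.mk (pullback.fst (𝟙 _) g ≫ X.hom)) (finiteType_pullback_over hg hX (𝟙 _)) :=
    cls_congr _ _ (Over.isoMk (asIso (pullback.snd (𝟙 _) g)).symm
      (by simp))
  rw [aux hf, aux hf', key]

end GrothendieckRing

/-! ### Splitting off a matrix factor -/

section Corner

variable {R A M N : Type u} [CommRing R] [Ring A] [Algebra R A] [AddCommGroup M] [Module R M]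
  [AddCommGroup N] [Module R N]

/-- The coefficient map `A ⊗ End(M) → A`, `a ⊗ T ↦ φ(T v) a`. -/
def matrixCoeff (φ : M →ₗ[R] R) (v : M) : A ⊗[R] Module.End R M →ₗ[R] A :=
  (TensorProduct.rid R A).toLinearMap ∘ₗ
    LinearMap.lTensor A (φ ∘ₗ LinearMap.applyₗ v)

theorem matrixCoeff_tmul (φ : M →ₗ[R] R) (v : M) (a : A) (T : Module.End R M) :
    matrixCoeff φ v (a ⊗ₜ T) = φ (T v) • a := by
  simp [matrixCoeff]

/-- The corner of `A ⊗ End(M)` cut out by the rank one operator `φ(-) v` consists of the elements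
`a ⊗ φ(-) v`. -/
theorem mul_mul_eq_matrixCoeff_tmul (φ : M →ₗ[R] R) (v : M) (y : A ⊗[R] Module.End R M) :
    ((1 : A) ⊗ₜ[R] (φ.smulRight v : Module.End R M)) * y * ((1 : A) ⊗ₜ[R] (φ.smulRight v)) =
      matrixCoeff φ v y ⊗ₜ[R] (φ.smulRight v) := by
  induction y with
  | zero => simp
  | add x y hx hy => simp only [mul_add, add_mul, map_add, add_tmul, hx, hy]
  | tmul a T =>
    rw [matrixCoeff_tmul, Algebra.TensorProduct.tmul_mul_tmul, Algebra.TensorProduct.tmul_mul_tmul,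
      one_mul, mul_one, smul_tmul]
    congr 1
    ext m
    simp [smul_smul, mul_comm]

/-- If `A ⊗ End(M) ≅ End(N)` and `M` has a free direct summand of rank one, given by `v ∈ M` and
`φ ∈ M*` with `φ v = 1`, then `A ≅ End(V)` for the direct summand `V = e(1 ⊗ v φ) N` of `N`. -/
theorem exists_algEquiv_end (e : A ⊗[R] Module.End R M ≃ₐ[R] Module.End R N)
    (φ : M →ₗ[R] R) (v : M) (hφ : φ v = 1) [Module.Finite R N] [Module.Projective R N] :
    ∃ (V : Type u) (_ : AddCommGroup V) (_ : Module R V), Module.Finite R V ∧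
      Module.Projective R V ∧ Nonempty (A ≃ₐ[R] Module.End R V) := by
  let p : Module.End R M := φ.smulRight v
  have hp : p * p = p := by ext m; simp [p, hφ]
  let q : Module.End R N := e (1 ⊗ₜ p)
  have hq : q * q = q := by
    rw [← map_mul, Algebra.TensorProduct.tmul_mul_tmul, one_mul, hp]
  have hqq (n : N) : q (q n) = q n := LinearMap.congr_fun hq n
  let V := LinearMap.range q
  let π : N →ₗ[R] V := q.rangeRestrict
  have hπ (w : V) : π w = w := by
    obtain ⟨_, n, rfl⟩ := w
    exact Subtype.ext (hqq n)
  have hfin : Module.Finite R V := Module.Finite.of_surjective π q.surjective_rangeRestrict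
  have hproj : Module.Projective R V :=
    Module.Projective.of_split V.subtype π (LinearMap.ext fun w => hπ w)
  have hcomm (a : A) : e (a ⊗ₜ 1) * q = q * e (a ⊗ₜ 1) := by
    rw [← map_mul, ← map_mul, Algebra.TensorProduct.tmul_mul_tmul,
      Algebra.TensorProduct.tmul_mul_tmul]
    simp
  have hmul (a : A) : e (a ⊗ₜ 1) * q = e (a ⊗ₜ p) := by
    rw [← map_mul, Algebra.TensorProduct.tmul_mul_tmul, mul_one, one_mul]
  have hmap (a : A) (w : V) : q (e (a ⊗ₜ 1) w) = e (a ⊗ₜ 1) w := by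
    obtain ⟨_, n, rfl⟩ := w
    have := LinearMap.congr_fun (hcomm a) (q n)
    exact this.symm.trans (congrArg (e (a ⊗ₜ 1)) (hqq n))
  let f : A →ₐ[R] Module.End R V := AlgHom.ofLinearMap
    { toFun := fun a => π ∘ₗ e (a ⊗ₜ 1) ∘ₗ V.subtype
      map_add' := fun a b => by ext w; simp [add_tmul]
      map_smul' := fun r a => by
        rw [← smul_tmul', map_smul]
        ext w
        simp }
    (by
      ext w
      simp [← Algebra.TensorProduct.one_def, hπ])
    (fun a b => by
      ext w
      have h1 : ((a * b) ⊗ₜ[R] (1 : Module.End R M)) = (a ⊗ₜ 1) * (b ⊗ₜ 1) := by simp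
      change q (e ((a * b) ⊗ₜ 1) w) = q (e (a ⊗ₜ 1) (q (e (b ⊗ₜ 1) w)))
      rw [h1, map_mul, hmap b]; rfl)
  have hf (a : A) (w : V) : (f a w : N) = e (a ⊗ₜ 1) w := hmap a w
  refine ⟨V, inferInstance, inferInstance, hfin, hproj, ⟨AlgEquiv.ofBijective f ⟨?_, ?_⟩⟩⟩
  -- If `a` acts as zero on `V`, then `a ⊗ p = 0`, and `matrixCoeff` recovers `a` from `a ⊗ p`.
  · rw [injective_iff_map_eq_zero]
    intro a ha
    have h0 : e (a ⊗ₜ p) = 0 := by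
      rw [← hmul]
      ext n
      have := hf a (π n)
      rw [ha] at this
      exact this.symm
    have h1 : a ⊗ₜ[R] p = 0 := by simpa using h0
    have h2 := matrixCoeff_tmul φ v a p
    rw [h1, map_zero] at h2
    simpa [p, hφ] using h2.symm
  -- An endomorphism of `V`, extended by zero to `N`, is a fixed point of `q * _ * q`, so that it
  -- comes from an element `a ⊗ p`.
  · intro ψ
    let y := e.symm (V.subtype ∘ₗ ψ ∘ₗ π)
    refine ⟨matrixCoeff φ v y, ?_⟩
    have h1 : e (matrixCoeff φ v y ⊗ₜ p) = V.subtype ∘ₗ ψ ∘ₗ π := by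
      rw [← mul_mul_eq_matrixCoeff_tmul, map_mul, map_mul, AlgEquiv.apply_symm_apply]
      ext n
      change q (ψ (π (q n))) = ψ (π n)
      have : π (q n) = π n := hπ (π n)
      rw [this]
      exact congrArg Subtype.val (hπ (ψ (π n)))
    ext w
    rw [hf]
    have h2 := LinearMap.congr_fun (hmul (matrixCoeff φ v y)) (w : N)
    rw [h1] at h2
    have h3 : q w = w := congrArg Subtype.val (hπ w)
    have h4 : e (matrixCoeff φ v y ⊗ₜ 1) (q w) = ψ (π w) := h2
    rwa [h3, hπ] at h4

end Corner

theorem exists_free_localizationAway (R M : Type u) [CommRing R] [AddCommGroup M] [Module R M]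
    [Module.Finite R M] [Module.Projective R M] (p : PrimeSpectrum R) :
    ∃ f ∉ p.asIdeal, Module.Free (Localization.Away f) (Localization.Away f ⊗[R] M) := by
  have : Module.FinitePresentation R M := Module.finitePresentation_of_projective R M
  have hp : p ∈ Module.freeLocus R M := by rw [Module.freeLocus_eq_univ]; trivial
  have : Module.Free _ _ := hp
  obtain ⟨f, hf, hf', -⟩ := Module.FinitePresentation.exists_free_localizedModule_powers
    p.asIdeal.primeCompl (LocalizedModule.mkLinearMap p.asIdeal.primeCompl M)
    (Localization.AtPrime p.asIdeal)
  exact ⟨f, hf, .of_equiv (LocalizedModule.equivTensorProduct (.powers f) M)⟩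

theorem mem_range_specMap_localizationAway_comp {X : Scheme.{u}} {R : Type u} [CommRing R]
    (v : Spec (.of R) ⟶ X) (p : PrimeSpectrum R) {f : R} (hf : f ∉ p.asIdeal) :
    v p ∈ Set.range (Spec.map (CommRingCat.ofHom (algebraMap R (Localization.Away f))) ≫ v) := by
  have h : p ∈ Set.range (PrimeSpectrum.comap (algebraMap R (Localization.Away f))) := by
    rw [PrimeSpectrum.localization_away_comap_range (Localization.Away f) f]
    exact hf
  obtain ⟨q, hq⟩ := h
  exact ⟨q, congrArg v hq⟩

theorem exists_spec_isOpenImmersion (X : Scheme.{u}) (x : X) :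
    ∃ (R : Type u) (_ : CommRing R) (v : Spec (.of R) ⟶ X), IsOpenImmersion v ∧
      x ∈ Set.range v :=
  ⟨_, inferInstance, X.affineCover.f (X.affineCover.idx x),
    inferInstanceAs (IsOpenImmersion (X.affineCover.f _)), X.affineCover.covers x⟩

/-- Zariski locally, an Azumaya algebra of degree `m` and trivial Brauer class is a matrix
algebra. -/
theorem exists_algEquiv_matrix {X : Scheme.{u}} {A : Azumaya X} {m : ℕ}
    (hA : ∀ (R : Type u) [CommRing R] (v : Spec (.of R) ⟶ X) (p : PrimeSpectrum R),
      Module.rankAtStalk (A.obj R v) p = m ^ 2)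
    (h : Azumaya.BrauerEquiv A (.trivial X)) (x : X) :
    ∃ (R : Type u) (_ : CommRing R) (v : Spec (.of R) ⟶ X), IsOpenImmersion v ∧
      x ∈ Set.range v ∧ Nonempty (A.obj R v ≃ₐ[R] Matrix (Fin m) (Fin m) R) := by
  obtain ⟨E, F, hE, -, ⟨e⟩⟩ := h
  obtain ⟨R, _, v, _, p, rfl⟩ := exists_spec_isOpenImmersion X x
  obtain ⟨f, hf, hfree⟩ := exists_free_localizationAway R (E.obj R v) p
  let R₁ := Localization.Away f
  let v₁ : Spec (.of R₁) ⟶ X := Spec.map (CommRingCat.ofHom (algebraMap R R₁)) ≫ v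
  obtain ⟨p₁, hp₁⟩ := mem_range_specMap_localizationAway_comp v p hf
  have : Module.Free R₁ (E.obj R₁ v₁) := .of_equiv (E.baseChange (x := v) (y := v₁) rfl)
  have : Nontrivial R₁ := p₁.nontrivial
  let b := Module.Free.chooseBasis R₁ (E.obj R₁ v₁)
  have : Nonempty (Module.Free.ChooseBasisIndex R₁ (E.obj R₁ v₁)) := by
    by_contra hne
    rw [not_nonempty_iff] at hne
    have := b.repr.toEquiv.subsingleton
    have := hE R₁ v₁ p₁
    rw [Module.rankAtStalk_eq_zero_of_subsingleton] at this
    exact lt_irrefl 0 this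
  obtain ⟨i⟩ := this
  obtain ⟨V, _, _, _, _, ⟨g⟩⟩ := exists_algEquiv_end
    ((e.equiv R₁ v₁).trans (Algebra.TensorProduct.lid R₁ (Module.End R₁ (F.obj R₁ v₁))))
    (b.coord i) (b i) (by simp)
  obtain ⟨f', hf', hfree'⟩ := exists_free_localizationAway R₁ V p₁
  let R₂ := Localization.Away f'
  let v₂ : Spec (.of R₂) ⟶ X := Spec.map (CommRingCat.ofHom (algebraMap R₁ R₂)) ≫ v₁
  have hv₁ : IsOpenImmersion v₁ := by
    have : IsOpenImmersion (Spec.map (CommRingCat.ofHom (algebraMap R R₁))) :=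
      inferInstanceAs (IsOpenImmersion
        (Spec.map (CommRingCat.ofHom (algebraMap R (Localization.Away f)))))
    infer_instance
  have hv₂ : IsOpenImmersion v₂ := by
    have : IsOpenImmersion (Spec.map (CommRingCat.ofHom (algebraMap R₁ R₂))) :=
      inferInstanceAs (IsOpenImmersion
        (Spec.map (CommRingCat.ofHom (algebraMap R₁ (Localization.Away f')))))
    infer_instance
  obtain ⟨p₂, hp₂⟩ := mem_range_specMap_localizationAway_comp v₁ p₁ hf'
  have : Nontrivial R₂ := p₂.nontrivial
  let b' := Module.Free.chooseBasis R₂ (R₂ ⊗[R₁] V)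
  let g' : A.obj R₂ v₂ ≃ₐ[R₂] Matrix _ _ R₂ :=
    (A.baseChange (x := v₁) (y := v₂) rfl).symm.trans
      ((Algebra.TensorProduct.congr .refl g).trans
        ((endBaseChangeEquiv R₁ R₂ V).trans (LinearMap.toMatrixAlgEquiv b')))
  have hrk := hA R₂ v₂ p₂
  rw [Module.rankAtStalk_eq_of_equiv g'.toLinearEquiv, Module.rankAtStalk_eq_finrank_of_free] at hrk
  change Module.finrank R₂ (Matrix _ _ R₂) = m ^ 2 at hrk
  rw [Module.finrank_matrix, Module.finrank_self, mul_one, ← sq] at hrk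
  have hcard := (Nat.pow_left_injective two_ne_zero) hrk
  exact ⟨R₂, inferInstance, v₂, hv₂, ⟨p₂, hp₂.trans hp₁⟩,
    ⟨g'.trans (Matrix.reindexAlgEquiv R₂ R₂ (Fintype.equivFinOfCardEq hcard))⟩⟩

/-! ### Left ideals of matrix rings -/

section Matrix

open Matrix

variable {n : ℕ} {B B' : Type u} [CommRing B] [CommRing B']

/-- The left ideal of the matrices all of whose rows are multiples of the row vector `l`. -/
def rowIdeal (l : Fin (n + 1) → B) : Ideal (Matrix (Fin (n + 1)) (Fin (n + 1)) B) where
  carrier := Set.range fun c => vecMulVec c l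
  zero_mem' := ⟨0, by simp⟩
  add_mem' := by
    rintro _ _ ⟨c, rfl⟩ ⟨d, rfl⟩
    exact ⟨c + d, by simp [add_vecMulVec]⟩
  smul_mem' := by
    rintro A _ ⟨c, rfl⟩
    exact ⟨A *ᵥ c, by simp [mul_vecMulVec]⟩

theorem rowIdeal_smul_le (r : B) (l : Fin (n + 1) → B) : rowIdeal (r • l) ≤ rowIdeal l := by
  rintro _ ⟨c, rfl⟩
  exact ⟨r • c, by simp [vecMulVec_smul, smul_vecMulVec]⟩

theorem eq_smul_of_minors {l l' : Fin (n + 1) → B} {j : Fin (n + 1)} (hj : l' j = 1)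
    (h : ∀ a b, l a * l' b = l b * l' a) : l = l j • l' := by
  ext a
  have := h a j
  simpa [hj] using this

/-- Two row vectors, each with a coordinate `1`, have the same row ideal if and only if the
`2 × 2` minors of the matrix formed by them vanish. -/
theorem rowIdeal_eq_iff {l l' : Fin (n + 1) → B} {i j : Fin (n + 1)} (hi : l i = 1)
    (hj : l' j = 1) : rowIdeal l = rowIdeal l' ↔ ∀ a b, l a * l' b = l b * l' a := by
  constructor
  · intro h a b
    have hl : vecMulVec (Pi.single i 1) l ∈ rowIdeal l' := h ▸ ⟨_, rfl⟩
    obtain ⟨c, hc⟩ := hl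
    have hc' (k) : l k = c i * l' k := by
      have := congrFun (congrFun hc i) k
      simpa [vecMulVec_apply] using this.symm
    rw [hc' a, hc' b]
    ring
  · intro h
    refine le_antisymm ?_ ?_
    · rw [eq_smul_of_minors hj h]
      exact rowIdeal_smul_le _ _
    · rw [eq_smul_of_minors hi (l := l') fun a b => by rw [mul_comm, ← h, mul_comm]]
      exact rowIdeal_smul_le _ _

theorem span_image_rowIdeal (s : B →+* B') (l : Fin (n + 1) → B) :
    Ideal.span ((fun M => M.map s) '' (rowIdeal l : Set (Matrix (Fin (n + 1)) (Fin (n + 1)) B))) =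
      rowIdeal (s ∘ l) := by
  refine le_antisymm (Ideal.span_le.mpr ?_) ?_
  · rintro _ ⟨_, ⟨c, rfl⟩, rfl⟩
    exact ⟨s ∘ c, by ext; simp [vecMulVec_apply]⟩
  · rintro _ ⟨c, rfl⟩
    let d : Fin (n + 1) → B := Pi.single 0 1
    let d' : Fin (n + 1) → B' := Pi.single 0 1
    have h : (vecMulVec d l).map s = vecMulVec d' (s ∘ l) := by
      ext a b
      by_cases ha : a = 0 <;> simp [vecMulVec_apply, ha, d, d']
    have h' : vecMulVec c (s ∘ l) = vecMulVec c d' * (vecMulVec d l).map s := by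
      rw [h, vecMulVec_mul_vecMulVec]
      simp [d']
    change vecMulVec c (s ∘ l) ∈ _
    rw [h']
    exact Ideal.mul_mem_left _ _ (Ideal.subset_span ⟨_, ⟨_, rfl⟩, rfl⟩)

theorem isBrauerSeveriPoint_rowIdeal {l : Fin (n + 1) → B} {i : Fin (n + 1)} (hi : l i = 1) :
    IsBrauerSeveriPoint (R := B) n (rowIdeal l) := by
  let N := Fin (n + 1)
  let I := (rowIdeal l).restrictScalars B
  constructor
  · let t : Matrix N N B →ₗ[B] Matrix N N B :=
      { toFun := fun M => M - vecMulVec (fun k => M k i) l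
        map_add' := fun M M' => by ext; simp [vecMulVec_apply]; ring
        map_smul' := fun r M => by ext; simp [vecMulVec_apply]; ring }
    have ht : I ≤ LinearMap.ker t := by
      rintro _ ⟨c, rfl⟩
      rw [LinearMap.mem_ker]
      ext
      simp [t, vecMulVec_apply, hi]
    refine Module.Projective.of_split (I.liftQ t ht) I.mkQ ?_
    refine I.linearMap_qext ?_
    ext M : 1
    refine (Submodule.Quotient.eq _).mpr ?_
    exact ⟨fun k => - M k i, by ext; simp [t, vecMulVec_apply]⟩
  · intro p
    let e : (N → B) ≃ₗ[B] I :=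
      { toFun := fun c => ⟨vecMulVec c l, c, rfl⟩
        map_add' := fun c d => Subtype.ext (add_vecMulVec _ _ _)
        map_smul' := fun r c => Subtype.ext (smul_vecMulVec _ _ _)
        invFun := fun M k => M.1 k i
        left_inv := fun c => by ext; simp [vecMulVec_apply, hi]
        right_inv := by
          rintro ⟨_, c, rfl⟩
          ext
          simp [vecMulVec_apply, hi] }
    have := p.nontrivial
    rw [← Module.rankAtStalk_eq_of_equiv e, Module.rankAtStalk_eq_finrank_of_free]
    simp [N]

/-- A submodule with projective quotient is a retract. -/
theorem exists_retraction {Q : Type u} [AddCommGroup Q] [Module B Q] (I : Submodule B Q)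
    [Module.Projective B (Q ⧸ I)] : ∃ r : Q →ₗ[B] I, r ∘ₗ I.subtype = LinearMap.id := by
  obtain ⟨s, hs⟩ := Module.projective_lifting_property I.mkQ LinearMap.id I.mkQ_surjective
  have hs' (x : Q) : I.mkQ (s (I.mkQ x)) = I.mkQ x := LinearMap.congr_fun hs (I.mkQ x)
  refine ⟨(LinearMap.id - s ∘ₗ I.mkQ).codRestrict I fun x => ?_, ?_⟩
  · ext x
    have hx : Submodule.Quotient.mk (p := I) (x : Q) = 0 :=
      (Submodule.Quotient.mk_eq_zero I).mpr x.2
    simp [hx]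
  · rw [← Submodule.Quotient.mk_eq_zero, ← Submodule.mkQ_apply]
    simp [hs', -Submodule.mkQ_apply]

theorem vecMulVec_row_mem {I : Ideal (Matrix (Fin (n + 1)) (Fin (n + 1)) B)}
    {M : Matrix (Fin (n + 1)) (Fin (n + 1)) B} (hM : M ∈ I) (c : Fin (n + 1) → B)
    (a : Fin (n + 1)) : vecMulVec c (M a) ∈ I := by
  have : vecMulVec c (M a) = vecMulVec c (Pi.single a 1) * M := by
    rw [vecMulVec_mul]
    simp; rfl
  rw [this]
  exact I.mul_mem_left _ hM

theorem rowIdeal_le_of_row_mem {I : Ideal (Matrix (Fin (n + 1)) (Fin (n + 1)) B)}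
    {M : Matrix (Fin (n + 1)) (Fin (n + 1)) B} (hM : M ∈ I) (a : Fin (n + 1)) :
    rowIdeal (M a) ≤ I := by
  rintro _ ⟨c, rfl⟩
  exact vecMulVec_row_mem hM c a

/-- A left ideal which is a point of the Brauer–Severi scheme of a matrix ring is not contained in
the matrices over a prime ideal. -/
theorem IsBrauerSeveriPoint.exists_notMem {I : Ideal (Matrix (Fin (n + 1)) (Fin (n + 1)) B)}
    (hI : IsBrauerSeveriPoint (R := B) n I) (p : PrimeSpectrum B) :
    ∃ M ∈ I, ∃ a b, M a b ∉ p.asIdeal := by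
  by_contra! h
  let I' := I.restrictScalars B
  have := hI.1
  obtain ⟨r, hr⟩ := exists_retraction I'
  have hr' (x : I') : r x = x := LinearMap.congr_fun hr x
  have hsurj : Function.Surjective r := fun x => ⟨x, hr' x⟩
  have : Module.Finite B I' := .of_surjective r hsurj
  have : Module.Projective B I' := .of_split I'.subtype r hr
  -- The retraction `r` writes an element of `I` as a combination of elements `r (single a b 1)` of
  -- `I` with its entries as coefficients, so `I = p I`, against Nakayama's lemma and the rank.
  have hle : (⊤ : Submodule B I') ≤ p.asIdeal • (⊤ : Submodule B I') := by
    intro x _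
    rw [← hr' x, matrix_eq_sum_single x.1, map_sum]
    refine Submodule.sum_mem _ fun a _ => ?_
    rw [map_sum]
    refine Submodule.sum_mem _ fun b _ => ?_
    have : single a b (x.1 a b) = x.1 a b • (single a b 1 : Matrix _ _ B) := by simp [smul_single]
    rw [this, map_smul]
    exact Submodule.smul_mem_smul (h _ x.2 a b) trivial
  obtain ⟨s, hs, hs'⟩ := Submodule.exists_sub_one_mem_and_smul_eq_zero_of_fg_of_le_smul
    p.asIdeal ⊤ Module.Finite.fg_top hle
  have hrk := hI.2 p
  have hpos : 0 < Module.rankAtStalk (R := B) I' p := by rw [hrk]; omega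
  rw [Module.rankAtStalk_pos_iff_mem_support, Module.mem_support_iff_exists_annihilator] at hpos
  obtain ⟨m, hm⟩ := hpos
  have h1 : s ∈ p.asIdeal := hm (by
    rw [Submodule.mem_annihilator_span_singleton]
    exact hs' m trivial)
  have : (1 : B) ∈ p.asIdeal := by simpa using sub_mem h1 hs
  exact p.isPrime.ne_top ((Ideal.eq_top_iff_one _).mpr this)

/-- A left ideal of rank `n + 1` which contains `rowIdeal l`, for a row vector `l` one of whose
coordinates is `1`, is equal to it: the matrices in `I` whose column `i` vanishes form a complement of
`rowIdeal l`, which is projective of rank zero. -/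
theorem IsBrauerSeveriPoint.eq_rowIdeal {I : Ideal (Matrix (Fin (n + 1)) (Fin (n + 1)) B)}
    (hI : IsBrauerSeveriPoint (R := B) n I) {l : Fin (n + 1) → B} {i : Fin (n + 1)}
    (hi : l i = 1) (hl : rowIdeal l ≤ I) : I = rowIdeal l := by
  let N := Fin (n + 1)
  let I' := I.restrictScalars B
  have := hI.1
  obtain ⟨r, hr⟩ := exists_retraction I'
  have hr' (x : I') : r x = x := LinearMap.congr_fun hr x
  have : Module.Finite B I' := .of_surjective r fun x => ⟨x, hr' x⟩
  have : Module.Projective B I' := .of_split I'.subtype r hr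
  let col : I' →ₗ[B] N → B :=
    { toFun := fun M k => M.1 k i
      map_add' := fun _ _ => rfl
      map_smul' := fun _ _ => rfl }
  let J := LinearMap.ker col
  let row : (N → B) →ₗ[B] I' :=
    { toFun := fun c => ⟨vecMulVec c l, hl ⟨c, rfl⟩⟩
      map_add' := fun c d => Subtype.ext (add_vecMulVec _ _ _)
      map_smul' := fun r c => Subtype.ext (smul_vecMulVec _ _ _) }
  have hcol (c) : col (row c) = c := by
    ext k
    change vecMulVec c l k i = c k
    simp [vecMulVec_apply, hi]
  let t : I' →ₗ[B] J := (LinearMap.id - row ∘ₗ col).codRestrict J fun x => by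
    rw [LinearMap.mem_ker]
    simp [hcol]
  have ht (x : J) : t x = x := by
    have : col x = 0 := x.2
    ext : 1
    simp [t, this]
  have ht' (x : I') : (t x : I') = x - row (col x) := rfl
  have : Module.Finite B J := .of_surjective t fun x => ⟨x, ht x⟩
  have : Module.Projective B J := .of_split J.subtype t (LinearMap.ext ht)
  let e : I' ≃ₗ[B] (N → B) × J :=
    { toFun := fun x => (col x, t x)
      map_add' := fun x y => by simp
      map_smul' := fun r x => by simp
      invFun := fun y => row y.1 + y.2
      left_inv := fun x => by simp [ht']
      right_inv := fun ⟨c, y⟩ => by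
        have h0 : col y = 0 := y.2
        refine Prod.ext ?_ ?_
        · simp [hcol, h0]
        · ext : 1
          simp [ht', hcol, h0] }
  have hJ : Module.rankAtStalk (R := B) J = 0 := by
    ext p
    have := p.nontrivial
    have h1 := hI.2 p
    change Module.rankAtStalk (R := B) I' p = n + 1 at h1
    rw [Module.rankAtStalk_eq_of_equiv (N := (N → B) × J) e, Module.rankAtStalk_prod,
      Module.rankAtStalk_eq_finrank_of_free] at h1
    simpa [N] using h1
  rw [Module.rankAtStalk_eq_zero_iff_subsingleton] at hJ
  refine le_antisymm (fun M hM => ?_) hl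
  have h0 : t ⟨M, hM⟩ = 0 := Subsingleton.elim _ _
  have h1 := congrArg (fun x : J => (x : I').1) h0
  refine ⟨fun k => M k i, ?_⟩
  exact (sub_eq_zero.mp h1).symm

end Matrix

/-! ### Gluing morphisms along families with local sections -/

section Gluing

universe v

variable {ι : Type v} {C : ι → Scheme.{u}} {X Y Z : Scheme.{u}}

/-- The family `f i : C i ⟶ X` has sections Zariski locally on `X`. -/
def HasLocalSections (f : ∀ i, C i ⟶ X) : Prop :=
  ∀ x : X, ∃ (V : Scheme.{u}) (v : V ⟶ X) (i : ι) (s : V ⟶ C i),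
    IsOpenImmersion v ∧ x ∈ Set.range v ∧ s ≫ f i = v

theorem HasLocalSections.hom_ext {f : ∀ i, C i ⟶ X} (hf : HasLocalSections f) {h h' : X ⟶ Y}
    (H : ∀ i, f i ≫ h = f i ≫ h') : h = h' := by
  choose V v i s hv hx hs using hf
  let 𝒰 : X.OpenCover := Scheme.Cover.mkOfCovers X V v (fun x => ⟨x, hx x⟩) hv
  refine Scheme.Cover.hom_ext 𝒰 _ _ fun x => ?_
  change v x ≫ h = v x ≫ h'
  rw [← hs x, Category.assoc, Category.assoc, H]

/-- If `f` has local sections, then a family `g` which identifies all pairs of affine points that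
`f` identifies factors through `f`. -/
theorem HasLocalSections.exists_desc {f : ∀ i, C i ⟶ X} (hf : HasLocalSections f)
    (g : ∀ i, C i ⟶ Y)
    (H : ∀ (i j : ι) (B : CommRingCat.{u}) (a : Spec B ⟶ C i) (b : Spec B ⟶ C j),
      a ≫ f i = b ≫ f j → a ≫ g i = b ≫ g j) :
    ∃ h : X ⟶ Y, ∀ i, f i ≫ h = g i := by
  have H' : ∀ (i j : ι) (T : Scheme.{u}) (a : T ⟶ C i) (b : T ⟶ C j),
      a ≫ f i = b ≫ f j → a ≫ g i = b ≫ g j := by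
    intro i j T a b hab
    refine Scheme.Cover.hom_ext T.affineCover _ _ fun k => ?_
    have hk := H i j _ (T.affineCover.f k ≫ a) (T.affineCover.f k ≫ b)
      ((Category.assoc _ _ _).trans ((congrArg _ hab).trans (Category.assoc _ _ _).symm))
    exact (Category.assoc _ _ _).symm.trans (hk.trans (Category.assoc _ _ _))
  choose V v i s hv hx hs using hf
  let 𝒰 : X.OpenCover := Scheme.Cover.mkOfCovers X V v (fun x => ⟨x, hx x⟩) hv
  have hglue : ∀ x y : X, pullback.fst (v x) (v y) ≫ s x ≫ g (i x) =
      pullback.snd (v x) (v y) ≫ s y ≫ g (i y) := fun x y => by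
    rw [← Category.assoc, ← Category.assoc]
    refine H' _ _ _ _ _ ?_
    rw [Category.assoc, Category.assoc, hs, hs, pullback.condition]
  let h : X ⟶ Y := 𝒰.glueMorphisms (fun x => s x ≫ g (i x)) hglue
  have hh (x : X) : v x ≫ h = s x ≫ g (i x) := 𝒰.ι_glueMorphisms _ hglue x
  refine ⟨h, fun k => Scheme.Cover.hom_ext (𝒰.pullback₁ (f k)) _ _ fun (x : X) => ?_⟩
  change pullback.fst (f k) (v x) ≫ f k ≫ h = pullback.fst (f k) (v x) ≫ g k
  rw [pullback.condition_assoc, hh, ← Category.assoc]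
  refine H' _ _ _ _ _ ?_
  rw [Category.assoc, hs, pullback.condition]

/-- Two schemes over `Z` which receive families with local sections from the same schemes, with the
same identifications of affine points, are isomorphic over `Z`. -/
theorem exists_iso_of_hasLocalSections {f : ∀ i, C i ⟶ X} {g : ∀ i, C i ⟶ Y}
    (hf : HasLocalSections f) (hg : HasLocalSections g) (p : X ⟶ Z) (q : Y ⟶ Z)
    (hpq : ∀ i, f i ≫ p = g i ≫ q)
    (H : ∀ (i j : ι) (B : CommRingCat.{u}) (a : Spec B ⟶ C i) (b : Spec B ⟶ C j),
      a ≫ f i = b ≫ f j ↔ a ≫ g i = b ≫ g j) :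
    ∃ e : X ≅ Y, e.hom ≫ q = p := by
  obtain ⟨h, hh⟩ := hf.exists_desc g fun i j B a b => (H i j B a b).mp
  obtain ⟨h', hh'⟩ := hg.exists_desc f fun i j B a b => (H i j B a b).mpr
  refine ⟨⟨h, h', hf.hom_ext fun i => ?_, hg.hom_ext fun i => ?_⟩, hf.hom_ext fun i => ?_⟩
  · rw [← Category.assoc, hh, hh', Category.comp_id]
  · rw [← Category.assoc, hh', hh, Category.comp_id]
  · rw [← Category.assoc, hh, hpq]

end Gluing

/-! ### Affine points of projective space -/

section ProjPoints

open MvPolynomial HomogeneousLocalization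

attribute [local instance] MvPolynomial.gradedAlgebra

variable {n : ℕ} {B B' : Type u} [CommRing B] [CommRing B']

/-- The grading of the homogeneous coordinate ring of projective space over the integers. -/
abbrev grading (n : ℕ) : ℕ → Submodule (ULift.{u} ℤ) (MvPolynomial (Fin (n + 1)) (ULift.{u} ℤ)) :=
  homogeneousSubmodule (Fin (n + 1)) (ULift.{u} ℤ)

/-- Evaluation of integral polynomials at a vector over a ring. -/
def evalVec (b : Fin (n + 1) → B) : MvPolynomial (Fin (n + 1)) (ULift.{u} ℤ) →+* B :=
  eval₂Hom ((Int.castRingHom B).comp (ULift.ringEquiv : ULift.{u} ℤ ≃+* ℤ).toRingHom) b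

@[simp]
theorem evalVec_X (b : Fin (n + 1) → B) (i : Fin (n + 1)) : evalVec b (X i) = b i :=
  eval₂Hom_X' _ _ _

theorem uliftInt_ringHom_ext (f g : ULift.{u} ℤ →+* B) : f = g := by
  ext x
  have := RingHom.ext_int (f.comp (ULift.ringEquiv.{0, u} : ULift.{u} ℤ ≃+* ℤ).symm.toRingHom)
    (g.comp (ULift.ringEquiv : ULift.{u} ℤ ≃+* ℤ).symm.toRingHom)
  exact RingHom.congr_fun this x.down

theorem evalVec_unique (φ : MvPolynomial (Fin (n + 1)) (ULift.{u} ℤ) →+* B) :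
    φ = evalVec fun i => φ (X i) :=
  MvPolynomial.ringHom_ext' (uliftInt_ringHom_ext _ _) fun i => by rw [evalVec_X]

theorem comp_evalVec (s : B →+* B') (b : Fin (n + 1) → B) :
    s.comp (evalVec b) = evalVec (s ∘ b) := by
  rw [evalVec_unique (s.comp (evalVec b))]
  congr 1
  ext i
  simp

theorem evalVec_smul (r : B) (b : Fin (n + 1) → B) {d : ℕ}
    {p : MvPolynomial (Fin (n + 1)) (ULift.{u} ℤ)} (hp : p.IsHomogeneous d) :
    evalVec (r • b) p = r ^ d * evalVec b p := by
  simp only [evalVec, coe_eval₂Hom, eval₂_eq']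
  rw [Finset.mul_sum]
  refine Finset.sum_congr rfl fun m hm => ?_
  have hd : ∑ i, m i = d := by
    rw [← Finsupp.degree_eq_sum, Finsupp.degree_eq_weight_one]
    exact hp (mem_support_iff.mp hm)
  simp only [Pi.smul_apply, smul_eq_mul, mul_pow, Finset.prod_mul_distrib,
    Finset.prod_pow_eq_pow_sum, hd]
  ring

/-- Evaluation at `b` of the fractions of degree zero with denominator a power of `f`. -/
def evalAway (b : Fin (n + 1) → B) (f : MvPolynomial (Fin (n + 1)) (ULift.{u} ℤ))
    (hf : IsUnit (evalVec b f)) : Away (grading.{u} n) f →+* B :=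
  (Localization.awayLift (evalVec b) f hf).comp
    (algebraMap (Away (grading.{u} n) f) (Localization.Away f))

theorem evalAway_mk_mul {b : Fin (n + 1) → B} {f : MvPolynomial (Fin (n + 1)) (ULift.{u} ℤ)}
    (hb : IsUnit (evalVec b f)) {d : ℕ} (hf : f ∈ grading.{u} n d) (k : ℕ)
    (p : MvPolynomial (Fin (n + 1)) (ULift.{u} ℤ)) (hp : p ∈ grading.{u} n (k • d)) :
    evalAway b f hb (Away.mk _ hf k p hp) * evalVec b f ^ k = evalVec b p := by
  obtain ⟨v, hv⟩ := isUnit_iff_exists_inv.mp hb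
  have h : evalAway b f hb (Away.mk _ hf k p hp) = evalVec b p * v ^ k :=
    Localization.awayLift_mk (evalVec b) f p v hv k
  rw [h, mul_assoc, ← mul_pow, mul_comm v, hv, one_pow, mul_one]

theorem eq_evalAway {b : Fin (n + 1) → B} {f : MvPolynomial (Fin (n + 1)) (ULift.{u} ℤ)}
    (hb : IsUnit (evalVec b f)) {d : ℕ} (hf : f ∈ grading.{u} n d)
    {φ : Away (grading.{u} n) f →+* B}
    (h : ∀ k p hp, φ (Away.mk _ hf k p hp) * evalVec b f ^ k = evalVec b p) :
    φ = evalAway b f hb := by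
  ext x
  obtain ⟨k, p, hp, rfl⟩ := Away.mk_surjective (grading.{u} n) hf x
  refine (hb.pow k).mul_left_injective ?_
  change _ * _ = _ * _
  rw [h, evalAway_mk_mul]

theorem comp_evalAway (s : B →+* B') (b : Fin (n + 1) → B)
    {f : MvPolynomial (Fin (n + 1)) (ULift.{u} ℤ)} (hb : IsUnit (evalVec b f))
    (hb' : IsUnit (evalVec (s ∘ b) f)) {d : ℕ} (hf : f ∈ grading.{u} n d) :
    s.comp (evalAway b f hb) = evalAway (s ∘ b) f hb' := by
  refine eq_evalAway hb' hf fun k p hp => ?_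
  rw [← comp_evalVec, RingHom.comp_apply, RingHom.comp_apply, ← map_pow, ← map_mul,
    evalAway_mk_mul, RingHom.comp_apply]

theorem evalAway_smul (r : B) (b : Fin (n + 1) → B)
    {f : MvPolynomial (Fin (n + 1)) (ULift.{u} ℤ)} (hb : IsUnit (evalVec b f))
    (hb' : IsUnit (evalVec (r • b) f)) {d : ℕ} (hf : f ∈ grading.{u} n d) :
    evalAway b f hb = evalAway (r • b) f hb' := by
  refine eq_evalAway hb' hf fun k p hp => ?_
  rw [evalVec_smul r b hf, evalVec_smul r b hp, ← evalAway_mk_mul hb hf k p hp]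
  simp only [smul_eq_mul]
  ring

theorem evalAway_comp_awayMap (b : Fin (n + 1) → B)
    {f g x : MvPolynomial (Fin (n + 1)) (ULift.{u} ℤ)} (hx : x = f * g)
    (hb : IsUnit (evalVec b f)) (hb' : IsUnit (evalVec b x)) {d e : ℕ} (hf : f ∈ grading.{u} n d)
    (hg : g ∈ grading.{u} n e) :
    (evalAway b x hb').comp (awayMap (grading.{u} n) hg hx) = evalAway b f hb := by
  refine eq_evalAway hb hf fun k p hp => ?_
  have hg' : IsUnit (evalVec b g) := by
    rw [hx, map_mul] at hb'
    exact isUnit_of_mul_isUnit_right hb'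
  refine (hg'.pow k).mul_left_injective ?_
  have h : evalVec b f ^ k * evalVec b g ^ k = evalVec b x ^ k := by rw [hx, map_mul, mul_pow]
  change _ * _ = _ * _
  rw [RingHom.comp_apply, awayMap_mk, mul_assoc, h, evalAway_mk_mul, map_mul, map_pow]

theorem X_mem_grading (i : Fin (n + 1)) : X i ∈ grading.{u} n 1 :=
  isHomogeneous_X _ i

/-- The affine point of projective space with homogeneous coordinates `b`, where `b i = 1`. -/
def coordPoint (b : Fin (n + 1) → B) (i : Fin (n + 1)) (hi : b i = 1) :
    Spec (.of B) ⟶ Proj (grading.{u} n) :=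
  Spec.map (CommRingCat.ofHom (evalAway b (X i) (by simp [hi]))) ≫
    Proj.awayι (grading.{u} n) (X i) (X_mem_grading i) one_pos

theorem specMap_comp_coordPoint (s : B →+* B') (b : Fin (n + 1) → B) (i : Fin (n + 1))
    (hi : b i = 1) : Spec.map (CommRingCat.ofHom s) ≫ coordPoint b i hi =
      coordPoint (s ∘ b) i (by simp [hi]) := by
  unfold coordPoint
  rw [← Category.assoc, ← Spec.map_comp, ← CommRingCat.ofHom_comp,
    comp_evalAway s b _ (by simp [hi]) (X_mem_grading i)]

/-- Evaluation at `b` gives the same point of projective space in the charts of `f` and of `f g`. -/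
theorem specMap_evalAway_comp_awayι (b : Fin (n + 1) → B)
    {f g x : MvPolynomial (Fin (n + 1)) (ULift.{u} ℤ)} (hx : x = f * g)
    (hb : IsUnit (evalVec b f)) (hb' : IsUnit (evalVec b x)) {d e : ℕ} (hf : f ∈ grading.{u} n d)
    (hg : g ∈ grading.{u} n e) (hd : 0 < d) {m : ℕ} (hxm : x ∈ grading.{u} n m) (hm : 0 < m) :
    Spec.map (CommRingCat.ofHom (evalAway b f hb)) ≫ Proj.awayι (grading.{u} n) f hf hd =
      Spec.map (CommRingCat.ofHom (evalAway b x hb')) ≫ Proj.awayι (grading.{u} n) x hxm hm := by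
  rw [← evalAway_comp_awayMap b hx hb hb' hf hg, CommRingCat.ofHom_comp, Spec.map_comp,
    Category.assoc, Proj.SpecMap_awayMap_awayι]
  rfl

/-- The fraction `X j / X i`. -/
def coordFrac (i j : Fin (n + 1)) : Away (grading.{u} n) (X i) :=
  Away.mk _ (X_mem_grading i) 1 (X j) (X_mem_grading j)

theorem evalAway_coordFrac {b : Fin (n + 1) → B} {i : Fin (n + 1)} (hi : b i = 1)
    (hb : IsUnit (evalVec b (X i))) (j : Fin (n + 1)) :
    evalAway b (X i) hb (coordFrac i j) = b j := by
  have := evalAway_mk_mul hb (X_mem_grading i) 1 (X j) (X_mem_grading j)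
  rwa [evalVec_X, evalVec_X, hi, one_pow, mul_one] at this

/-- Affine points with coordinates `b` and `b'` are equal if and only if the `2 × 2` minors vanish:
from an equality, the point lies in the chart of `X i * X j`, where
`(X a / X i) (X c / X j) = (X c / X i) (X a / X j)`; conversely `b'` is a multiple of `b`. -/
theorem coordPoint_eq_iff {b b' : Fin (n + 1) → B} {i j : Fin (n + 1)} (hi : b i = 1)
    (hj : b' j = 1) :
    coordPoint.{u} b i hi = coordPoint b' j hj ↔ ∀ a c, b a * b' c = b c * b' a := by
  have hbi : IsUnit (evalVec b (X i)) := by simp [hi]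
  have hbj : IsUnit (evalVec b' (X j)) := by simp [hj]
  constructor
  · intro h a c
    unfold coordPoint at h
    let l := pullback.lift (f := Proj.awayι (grading.{u} n) (X i) (X_mem_grading i) one_pos)
      (g := Proj.awayι (grading.{u} n) (X j) (X_mem_grading j) one_pos) _ _ h ≫
      (Proj.pullbackAwayιIso (grading.{u} n) (X_mem_grading i) one_pos (X_mem_grading j) one_pos
        rfl).hom
    obtain ⟨γ, hγ⟩ : ∃ γ : Away (grading.{u} n) (X i * X j) →+* B,
        Spec.map (CommRingCat.ofHom γ) = l :=
      ⟨(Spec.preimage l).hom, by simp⟩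
    have h₁ : evalAway b (X i) hbi =
        γ.comp (awayMap (grading.{u} n) (X_mem_grading j) rfl) := by
      have : Spec.map (CommRingCat.ofHom (evalAway b (X i) hbi)) = Spec.map
          (CommRingCat.ofHom (γ.comp (awayMap (grading.{u} n) (X_mem_grading j) rfl))) := by
        rw [CommRingCat.ofHom_comp, Spec.map_comp, hγ]
        simp only [l, Category.assoc, Proj.pullbackAwayιIso_hom_SpecMap_awayMap_left]
        rw [pullback.lift_fst]
      exact congrArg CommRingCat.Hom.hom (Spec.map_injective this)
    have h₂ : evalAway b' (X j) hbj =
        γ.comp (awayMap (grading.{u} n) (X_mem_grading i) (mul_comm _ _)) := by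
      have : Spec.map (CommRingCat.ofHom (evalAway b' (X j) hbj)) = Spec.map
          (CommRingCat.ofHom (γ.comp (awayMap (grading.{u} n) (X_mem_grading i)
            (mul_comm _ _)))) := by
        rw [CommRingCat.ofHom_comp, Spec.map_comp, hγ]
        simp only [l, Category.assoc, Proj.pullbackAwayιIso_hom_SpecMap_awayMap_right]
        rw [pullback.lift_snd]
      exact congrArg CommRingCat.Hom.hom (Spec.map_injective this)
    have key : awayMap (grading.{u} n) (X_mem_grading j) rfl (coordFrac i a) *
          awayMap (grading.{u} n) (X_mem_grading i) (mul_comm _ _) (coordFrac j c) =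
        awayMap (grading.{u} n) (X_mem_grading j) rfl (coordFrac i c) *
          awayMap (grading.{u} n) (X_mem_grading i) (mul_comm _ _) (coordFrac j a) := by
      simp only [coordFrac, awayMap_mk]
      ext
      simp only [val_mul, Away.val_mk, Localization.mk_mul]
      congr 1
      ring
    rw [← evalAway_coordFrac hi hbi a, ← evalAway_coordFrac hi hbi c,
      ← evalAway_coordFrac hj hbj a, ← evalAway_coordFrac hj hbj c, h₁, h₂]
    simp only [RingHom.comp_apply]
    rw [← map_mul, key, map_mul]
  · intro h
    have hu : b j * b' i = 1 := by rw [h j i, hi, hj, one_mul]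
    have hb'' : b' = b' i • b := by
      ext a
      have := h i a
      rw [hi, one_mul] at this
      simp [this, mul_comm]
    have hbj' : IsUnit (evalVec b (X j)) := by
      rw [evalVec_X]
      exact IsUnit.of_mul_eq_one _ hu
    have hbx : IsUnit (evalVec b (X i * X j)) := by
      rw [map_mul]
      exact hbi.mul hbj'
    have hbj'' : IsUnit (evalVec (b' i • b) (X j)) := hb'' ▸ hbj
    have hsub : evalAway b' (X j) hbj = evalAway b (X j) hbj' := by
      rw [evalAway_smul (b' i) b hbj' hbj'' (X_mem_grading j)]
      congr 1
    unfold coordPoint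
    rw [hsub, specMap_evalAway_comp_awayι b rfl hbi hbx (X_mem_grading i) (X_mem_grading j) one_pos
      (SetLike.mul_mem_graded (X_mem_grading i) (X_mem_grading j)) two_pos,
      specMap_evalAway_comp_awayι b (mul_comm (X i) (X j)) hbj' hbx (X_mem_grading j)
      (X_mem_grading i) one_pos
      (SetLike.mul_mem_graded (X_mem_grading i) (X_mem_grading j)) two_pos]

/-- Substituting `X j / X i` for `X j` dehomogenizes a polynomial. -/
theorem evalVec_coordFrac (i : Fin (n + 1)) (k : ℕ) (p : MvPolynomial (Fin (n + 1)) (ULift.{u} ℤ))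
    (hp : p ∈ grading.{u} n (k • 1)) :
    evalVec (coordFrac i) p = Away.mk _ (X_mem_grading i) k p hp := by
  let L := Localization.Away (X i : MvPolynomial (Fin (n + 1)) (ULift.{u} ℤ))
  let v : Away (grading.{u} n) (X i) →+* L := algebraMap _ _
  let w : L := Localization.mk 1 ⟨X i, 1, pow_one _⟩
  apply val_injective
  change v (evalVec (coordFrac i) p) = Localization.mk p ⟨X i ^ k, (⟨k, rfl⟩ : ∃ m, X i ^ m = X i ^ k)⟩
  have h : v ∘ coordFrac i =
      w • fun j => algebraMap (MvPolynomial (Fin (n + 1)) (ULift.{u} ℤ)) L (X j) := by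
    ext j
    change Localization.mk (X j) ⟨X i ^ 1, (⟨1, rfl⟩ : ∃ m, X i ^ m = X i ^ 1)⟩ = w * algebraMap _ _ (X j)
    rw [← Localization.mk_one_eq_algebraMap, Localization.mk_mul]
    simp
  rw [← RingHom.comp_apply, comp_evalVec, h, evalVec_smul w _ hp,
    ← evalVec_unique (algebraMap (MvPolynomial (Fin (n + 1)) (ULift.{u} ℤ)) L),
    ← Localization.mk_one_eq_algebraMap, Localization.mk_pow, Localization.mk_mul]
  simp only [one_pow, one_mul, smul_eq_mul, mul_one]
  rfl

/-- An affine point in the chart `X i ≠ 0` has homogeneous coordinates whose `i`-th one is `1`. -/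
theorem exists_eq_coordPoint {v : Spec (.of B) ⟶ Proj (grading.{u} n)} {i : Fin (n + 1)}
    (hv : Set.range v ⊆
      Set.range (Proj.awayι (grading.{u} n) (X i) (X_mem_grading i) one_pos)) :
    ∃ (b : Fin (n + 1) → B) (hi : b i = 1), v = coordPoint b i hi := by
  let w := IsOpenImmersion.lift (Proj.awayι (grading.{u} n) (X i) (X_mem_grading i) one_pos) v hv
  have hw : w ≫ Proj.awayι (grading.{u} n) (X i) (X_mem_grading i) one_pos = v :=
    IsOpenImmersion.lift_fac _ _ _
  obtain ⟨α, hα⟩ : ∃ α : Away (grading.{u} n) (X i) →+* B,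
      Spec.map (CommRingCat.ofHom α) = w := ⟨(Spec.preimage w).hom, by simp⟩
  have h1 : coordFrac.{u} i i = 1 := by
    apply val_injective
    rw [val_one]
    change Localization.mk (X i) ⟨X i ^ 1, (⟨1, rfl⟩ : ∃ m, X i ^ m = X i ^ 1)⟩ = 1
    simp only [pow_one]
    exact Localization.mk_self ⟨X i, _⟩
  have hi : α (coordFrac i i) = 1 := by rw [h1, map_one]
  refine ⟨fun j => α (coordFrac i j), hi, ?_⟩
  rw [← hw, ← hα]
  unfold coordPoint
  congr 3
  refine eq_evalAway _ (X_mem_grading i) fun k p hp => ?_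
  rw [evalVec_X, hi, one_pow, mul_one, ← evalVec_coordFrac i k p hp, ← RingHom.comp_apply,
    comp_evalVec]
  rfl

/-- The charts `X i ≠ 0` cover projective space. -/
theorem exists_mem_range_awayι (x : Proj (grading.{u} n)) : ∃ i : Fin (n + 1),
    x ∈ Set.range (Proj.awayι (grading.{u} n) (X i) (X_mem_grading i) one_pos) := by
  have h := Proj.iSup_basicOpen_eq_top' (grading.{u} n) (fun i : Fin (n + 1) => X i)
    (fun i => ⟨1, X_mem_grading i⟩) (by
      rw [eq_top_iff]
      rintro p -
      induction p using MvPolynomial.induction_on with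
      | C a => exact Subalgebra.algebraMap_mem _ (algebraMap (ULift.{u} ℤ) (grading.{u} n 0) a)
      | add p q hp hq => exact add_mem hp hq
      | mul_X p i hp => exact mul_mem hp (Algebra.subset_adjoin ⟨i, rfl⟩))
  have hx : x ∈ (⊤ : (Proj (grading.{u} n)).Opens) := trivial
  rw [← h] at hx
  obtain ⟨i, hi⟩ := TopologicalSpace.Opens.mem_iSup.mp hx
  refine ⟨i, ?_⟩
  rw [← Proj.opensRange_awayι (grading.{u} n) (X i) (X_mem_grading i) one_pos] at hi
  exact hi

end ProjPoints

/-! ### Affine points of the Brauer–Severi scheme of a matrix algebra -/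

theorem IsBrauerSeveriPoint.comap {n : ℕ} {B A A' : Type u} [CommRing B] [Ring A] [Algebra B A]
    [Ring A'] [Algebra B A'] (e : A ≃ₐ[B] A') {I : Ideal A'}
    (hI : IsBrauerSeveriPoint (R := B) n I) :
    IsBrauerSeveriPoint (R := B) n (I.comap e) := by
  have := hI.1
  let K := I.restrictScalars B
  let L := (I.comap e).restrictScalars B
  have hL : L.map (e.toLinearEquiv : A →ₗ[B] A') = K := by
    ext x
    constructor
    · rintro ⟨y, hy, rfl⟩
      exact hy
    · intro hx
      exact ⟨e.symm x, show e (e.symm x) ∈ I from (e.apply_symm_apply x).symm ▸ hx, by simp⟩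
  refine ⟨.of_equiv (Submodule.Quotient.equiv L K e.toLinearEquiv hL).symm, fun p => ?_⟩
  rw [← hI.2 p]
  exact congrFun (Module.rankAtStalk_eq_of_equiv
    ((e.toLinearEquiv.submoduleMap L).trans (LinearEquiv.ofEq _ _ hL))) p

section Trivialization

variable {S : Scheme.{u}} {R B B' : Type u} [CommRing R] [CommRing B] [CommRing B'] [Algebra R B]
  [Algebra R B'] [Algebra B B'] [IsScalarTower R B B']
  {x : Spec (.of R) ⟶ S} {y : Spec (.of B) ⟶ S} {z : Spec (.of B') ⟶ S} {n : ℕ}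

/-- The canonical isomorphism of `B`-algebras `B ⊗ Mₘ(R) ≅ Mₘ(B)`. -/
def tensorMatrixEquiv (m : ℕ) (R B : Type u) [CommRing R] [CommRing B] [Algebra R B] :
    B ⊗[R] Matrix (Fin m) (Fin m) R ≃ₐ[B] Matrix (Fin m) (Fin m) B :=
  AlgEquiv.ofRingEquiv (f := (matrixEquivTensor (Fin m) R B).symm.toRingEquiv) fun b => by
    change (matrixEquivTensor (Fin m) R B).symm (b ⊗ₜ 1) = _
    rw [matrixEquivTensor_apply_symm, Algebra.algebraMap_eq_smul_one]
    simp

theorem tensorMatrixEquiv_tmul {m : ℕ} (b : B) (M : Matrix (Fin m) (Fin m) R) :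
    tensorMatrixEquiv m R B (b ⊗ₜ M) = b • M.map (algebraMap R B) :=
  matrixEquivTensor_apply_symm (Fin m) R B b M

theorem QCAlgebra.res_smul (A : QCAlgebra S) (h : Restricts x y) (r : R) (a : A.obj R x) :
    A.res h (r • a) = algebraMap R B r • A.res h a := by
  rw [A.res_apply, A.res_apply, ← map_smul, algebraMap_smul, tmul_smul]

/-- The base change to `B` of an isomorphism of `A_R` with a matrix algebra. -/
def matrixBaseChange (A : QCAlgebra S) (θ : A.obj R x ≃ₐ[R] Matrix (Fin (n + 1)) (Fin (n + 1)) R)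
    (h : Restricts x y) : A.obj B y ≃ₐ[B] Matrix (Fin (n + 1)) (Fin (n + 1)) B :=
  (A.baseChange h).symm.trans
    ((Algebra.TensorProduct.congr .refl θ).trans (tensorMatrixEquiv (n + 1) R B))

theorem matrixBaseChange_baseChange (A : QCAlgebra S)
    (θ : A.obj R x ≃ₐ[R] Matrix (Fin (n + 1)) (Fin (n + 1)) R) (h : Restricts x y) (b : B)
    (a : A.obj R x) :
    matrixBaseChange A θ h (A.baseChange h (b ⊗ₜ a)) = b • (θ a).map (algebraMap R B) := by
  simp [matrixBaseChange, tensorMatrixEquiv_tmul]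

theorem matrixBaseChange_res (A : QCAlgebra S)
    (θ : A.obj R x ≃ₐ[R] Matrix (Fin (n + 1)) (Fin (n + 1)) R) (hy : Restricts x y)
    (hz : Restricts x z) (h : Restricts y z) (m : A.obj B y) :
    matrixBaseChange A θ hz (A.res h m) = (matrixBaseChange A θ hy m).map (algebraMap B B') := by
  obtain ⟨t, rfl⟩ := (A.baseChange hy).surjective m
  induction t with
  | zero => simp
  | add s t hs ht => simp [hs, ht, Matrix.map_add]
  | tmul b a =>
    have h₁ : A.res h (A.baseChange hy (b ⊗ₜ a)) = A.baseChange hz (algebraMap B B' b ⊗ₜ a) := by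
      have hb : b ⊗ₜ[R] a = b • ((1 : B) ⊗ₜ[R] a) := by
        rw [smul_tmul', smul_eq_mul, mul_one]
      have hb' : algebraMap B B' b ⊗ₜ[R] a = algebraMap B B' b • ((1 : B') ⊗ₜ[R] a) := by
        rw [smul_tmul', smul_eq_mul, mul_one]
      rw [hb, hb', map_smul, A.res_smul, map_smul, ← A.baseChange_comp hy h hz, A.res_apply]
    rw [h₁, matrixBaseChange_baseChange, matrixBaseChange_baseChange]
    ext i j
    simp [← IsScalarTower.algebraMap_apply]

/-- Base change of left ideals of `A_B` corresponds to base change of left ideals of matrix rings. -/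
theorem span_image_res_comap (A : QCAlgebra S)
    (θ : A.obj R x ≃ₐ[R] Matrix (Fin (n + 1)) (Fin (n + 1)) R) (hy : Restricts x y)
    (hz : Restricts x z) (h : Restricts y z) (I : Ideal (Matrix (Fin (n + 1)) (Fin (n + 1)) B)) :
    Ideal.span (A.res h '' (I.comap (matrixBaseChange A θ hy) : Set (A.obj B y))) =
      (Ideal.span ((fun M => M.map (algebraMap B B')) ''
        (I : Set (Matrix (Fin (n + 1)) (Fin (n + 1)) B)))).comap (matrixBaseChange A θ hz) := by
  refine le_antisymm (Ideal.span_le.mpr ?_) fun m hm => ?_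
  · rintro _ ⟨m, hm, rfl⟩
    refine Ideal.subset_span ⟨_, hm, ?_⟩
    exact (matrixBaseChange_res A θ hy hz h m).symm
  · have key : ∀ M ∈ Ideal.span ((fun M => M.map (algebraMap B B')) ''
        (I : Set (Matrix (Fin (n + 1)) (Fin (n + 1)) B))), (matrixBaseChange A θ hz).symm M ∈
        Ideal.span (A.res h '' (I.comap (matrixBaseChange A θ hy) : Set (A.obj B y))) := by
      intro M hM
      induction hM using Submodule.span_induction with
      | mem M hM =>
        obtain ⟨M, hM, rfl⟩ := hM
        refine Ideal.subset_span ⟨(matrixBaseChange A θ hy).symm M, ?_, ?_⟩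
        · simpa [Ideal.mem_comap] using hM
        · rw [AlgEquiv.eq_symm_apply, matrixBaseChange_res A θ hy hz h,
            AlgEquiv.apply_symm_apply]
      | zero => simp
      | add M M' _ _ hM hM' => rw [map_add]; exact add_mem hM hM'
      | smul a M _ hM => rw [smul_eq_mul, map_mul]; exact Ideal.mul_mem_left _ _ hM
    simpa using key _ hm

variable {A : Azumaya S} {P : Over S}

/-- The point of the Brauer–Severi scheme `P` of `A` given, in terms of an isomorphism of `A_R` with
a matrix algebra, by the row vector `l` with `l i = 1`. -/
def rowPoint (bs : BrauerSeveriOf n A P)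
    (θ : A.obj R x ≃ₐ[R] Matrix (Fin (n + 1)) (Fin (n + 1)) R) (h : Restricts x y)
    (l : Fin (n + 1) → B) (i : Fin (n + 1)) (hi : l i = 1) :
    {s : Spec (.of B) ⟶ P.left // s ≫ P.hom = y} :=
  (bs.equiv B y).symm ⟨(rowIdeal l).comap (matrixBaseChange A.toQCAlgebra θ h),
    (isBrauerSeveriPoint_rowIdeal hi).comap _⟩

theorem specMap_comp_rowPoint (bs : BrauerSeveriOf n A P)
    (θ : A.obj R x ≃ₐ[R] Matrix (Fin (n + 1)) (Fin (n + 1)) R) (hy : Restricts x y)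
    (hz : Restricts x z) (h : Restricts y z)
    (l : Fin (n + 1) → B) (i : Fin (n + 1)) (hi : l i = 1) :
    Spec.map (CommRingCat.ofHom (algebraMap B B')) ≫ (rowPoint bs θ hy l i hi).1 =
      (rowPoint bs θ hz (algebraMap B B' ∘ l) i (by simp [hi])).1 := by
  let s := rowPoint bs θ hy l i hi
  let t : {t : Spec (.of B') ⟶ P.left // t ≫ P.hom = z} :=
    ⟨Spec.map (CommRingCat.ofHom (algebraMap B B')) ≫ s.1, by
      rw [Category.assoc, s.2]; exact h.symm⟩
  refine congrArg Subtype.val (a₁ := t) ?_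
  unfold rowPoint
  rw [Equiv.eq_symm_apply]
  ext1
  rw [bs.naturality h s t rfl]
  simp only [s, rowPoint, Equiv.apply_symm_apply]
  rw [span_image_res_comap A.toQCAlgebra θ hy hz h, span_image_rowIdeal]

theorem rowPoint_eq_iff (bs : BrauerSeveriOf n A P)
    (θ : A.obj R x ≃ₐ[R] Matrix (Fin (n + 1)) (Fin (n + 1)) R) (h : Restricts x y)
    {l l' : Fin (n + 1) → B} {i j : Fin (n + 1)} (hi : l i = 1) (hj : l' j = 1) :
    rowPoint bs θ h l i hi = rowPoint bs θ h l' j hj ↔ ∀ a c, l a * l' c = l c * l' a := by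
  rw [← rowIdeal_eq_iff hi hj, rowPoint, rowPoint, Equiv.apply_eq_iff_eq, Subtype.mk.injEq]
  refine ⟨fun H => ?_, fun H => by rw [H]⟩
  refine Ideal.comap_injective_of_surjective (matrixBaseChange A.toQCAlgebra θ h)
    (matrixBaseChange A.toQCAlgebra θ h).surjective H

/-- Zariski locally, every point of the Brauer–Severi scheme of `A` is given by a row vector: at a
given prime some row of a matrix in the corresponding left ideal does not vanish. -/
theorem exists_eq_rowPoint (bs : BrauerSeveriOf n A P)
    (θ : A.obj R x ≃ₐ[R] Matrix (Fin (n + 1)) (Fin (n + 1)) R) (hy : Restricts x y)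
    (s : {s : Spec (.of B) ⟶ P.left // s ≫ P.hom = y}) (p : PrimeSpectrum B) :
    ∃ f ∉ p.asIdeal, ∀ (B' : Type u) [CommRing B'] [Algebra R B'] [Algebra B B']
      [IsScalarTower R B B'] (z : Spec (.of B') ⟶ S) (hz : Restricts x z) (_ : Restricts y z)
      (_ : IsUnit (algebraMap B B' f)), ∃ (l : Fin (n + 1) → B') (i : Fin (n + 1)) (hi : l i = 1),
        Spec.map (CommRingCat.ofHom (algebraMap B B')) ≫ s.1 = (rowPoint bs θ hz l i hi).1 := by
  let e := matrixBaseChange A.toQCAlgebra θ hy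
  obtain ⟨M, hM, a, b, hab⟩ := (((bs.equiv B y s).2).comap e.symm).exists_notMem p
  refine ⟨M a b, hab, fun B' _ _ _ _ z hz h hu => ?_⟩
  let t : {t : Spec (.of B') ⟶ P.left // t ≫ P.hom = z} :=
    ⟨Spec.map (CommRingCat.ofHom (algebraMap B B')) ≫ s.1, by
      rw [Category.assoc, s.2]; exact h.symm⟩
  let e' := matrixBaseChange A.toQCAlgebra θ hz
  have hI := ((bs.equiv B' z t).2).comap e'.symm
  have hM' : M.map (algebraMap B B') ∈ (bs.equiv B' z t).1.comap e'.symm := by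
    rw [Ideal.mem_comap, bs.naturality h s t rfl]
    refine Ideal.subset_span ⟨e.symm M, hM, ?_⟩
    rw [AlgEquiv.eq_symm_apply, matrixBaseChange_res A.toQCAlgebra θ hy hz h]
    exact congrArg (fun N => Matrix.map N (algebraMap B B')) (AlgEquiv.apply_symm_apply e M)
  let l : Fin (n + 1) → B' := (hu.unit⁻¹ : B'ˣ) • (M.map (algebraMap B B')) a
  have hl : l b = 1 := by
    change ((hu.unit⁻¹ : B'ˣ) : B') * algebraMap B B' (M a b) = 1
    exact hu.val_inv_mul
  have hle : rowIdeal l ≤ (bs.equiv B' z t).1.comap e'.symm :=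
    (rowIdeal_smul_le _ _).trans (rowIdeal_le_of_row_mem hM' a)
  have heq := hI.eq_rowIdeal hl hle
  refine ⟨l, b, hl, congrArg Subtype.val (a₁ := t) ?_⟩
  unfold rowPoint
  rw [Equiv.eq_symm_apply]
  ext1
  change _ = (rowIdeal l).comap e'
  rw [← heq]
  ext m
  simp [Ideal.mem_comap]

end Trivialization

/-! ### Comparison with projective space -/

section Comparison

attribute [local instance] MvPolynomial.gradedAlgebra

/-- A row vector with a coordinate equal to `1`, over a ring `B` under `R`. These data are the test
objects along which a Brauer–Severi scheme over `R` is compared with projective space. -/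
structure RowVector (n : ℕ) (R : Type u) [CommRing R] where
  B : Type u
  [commRing : CommRing B]
  hom : R →+* B
  l : Fin (n + 1) → B
  i : Fin (n + 1)
  hi : l i = 1

attribute [instance] RowVector.commRing

namespace RowVector

variable {n : ℕ} {R : Type u} [CommRing R]

/-- The image of a row vector under a ring homomorphism. -/
def map (c : RowVector n R) {B' : Type u} [CommRing B'] (s : c.B →+* B') : RowVector n R where
  B := B'
  hom := s.comp c.hom
  l := s ∘ c.l
  i := c.i
  hi := by simp [c.hi]

variable {S : Scheme.{u}} {A : Azumaya S} {P : Over S} {x : Spec (.of R) ⟶ S}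

/-- The point of the Brauer–Severi scheme given by a row vector. -/
def toBrauerSeveri (bs : BrauerSeveriOf n A P)
    (θ : A.obj R x ≃ₐ[R] Matrix (Fin (n + 1)) (Fin (n + 1)) R) (c : RowVector n R) :
    Spec (.of c.B) ⟶ pullback x P.hom :=
  letI := c.hom.toAlgebra
  pullback.lift (Spec.map (CommRingCat.ofHom c.hom))
    (rowPoint bs θ (y := Spec.map (CommRingCat.ofHom c.hom) ≫ x) rfl c.l c.i c.hi).1
    (rowPoint bs θ _ c.l c.i c.hi).2.symm

/-- The point of projective space given by a row vector. -/
def toProjSpace (c : RowVector n R) : Spec (.of c.B) ⟶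
    pullback (terminal.from (Spec (.of R))) (terminal.from (projZ.{u} n)) :=
  pullback.lift (Spec.map (CommRingCat.ofHom c.hom)) (coordPoint c.l c.i c.hi)
    (terminal.hom_ext _ _)

theorem toProjSpace_fst (c : RowVector n R) : c.toProjSpace ≫ pullback.fst _ _ =
    Spec.map (CommRingCat.ofHom c.hom) := pullback.lift_fst _ _ _

theorem toProjSpace_snd (c : RowVector n R) : c.toProjSpace ≫ pullback.snd _ _ =
    coordPoint c.l c.i c.hi := pullback.lift_snd _ _ _

theorem toBrauerSeveri_fst (bs : BrauerSeveriOf n A P)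
    (θ : A.obj R x ≃ₐ[R] Matrix (Fin (n + 1)) (Fin (n + 1)) R) (c : RowVector n R) :
    c.toBrauerSeveri bs θ ≫ pullback.fst _ _ = Spec.map (CommRingCat.ofHom c.hom) :=
  pullback.lift_fst _ _ _

theorem toBrauerSeveri_snd (bs : BrauerSeveriOf n A P)
    (θ : A.obj R x ≃ₐ[R] Matrix (Fin (n + 1)) (Fin (n + 1)) R) (c : RowVector n R) :
    c.toBrauerSeveri bs θ ≫ pullback.snd _ _ =
      letI := c.hom.toAlgebra
      (rowPoint bs θ (y := Spec.map (CommRingCat.ofHom c.hom) ≫ x) rfl c.l c.i c.hi).1 :=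
  pullback.lift_snd _ _ _

theorem specMap_comp_toProjSpace (c : RowVector n R) {B' : Type u} [CommRing B']
    (s : c.B →+* B') :
    Spec.map (CommRingCat.ofHom s) ≫ c.toProjSpace = (c.map s).toProjSpace := by
  apply pullback.hom_ext
  · refine Eq.trans ?_ (c.map s).toProjSpace_fst.symm
    rw [Category.assoc, toProjSpace_fst]
    exact (Spec.map_comp _ _).symm
  · refine Eq.trans ?_ (c.map s).toProjSpace_snd.symm
    rw [Category.assoc, toProjSpace_snd]
    exact specMap_comp_coordPoint s c.l c.i c.hi

theorem specMap_comp_toBrauerSeveri (bs : BrauerSeveriOf n A P)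
    (θ : A.obj R x ≃ₐ[R] Matrix (Fin (n + 1)) (Fin (n + 1)) R) (c : RowVector n R) {B' : Type u}
    [CommRing B'] (s : c.B →+* B') :
    Spec.map (CommRingCat.ofHom s) ≫ c.toBrauerSeveri bs θ = (c.map s).toBrauerSeveri bs θ := by
  apply pullback.hom_ext
  · refine Eq.trans ?_ ((c.map s).toBrauerSeveri_fst bs θ).symm
    rw [Category.assoc, toBrauerSeveri_fst]
    exact (Spec.map_comp _ _).symm
  · refine Eq.trans ?_ ((c.map s).toBrauerSeveri_snd bs θ).symm
    rw [Category.assoc, toBrauerSeveri_snd]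
    let := c.hom.toAlgebra
    let := (s.comp c.hom).toAlgebra
    let := s.toAlgebra
    have : IsScalarTower R c.B B' := .of_algebraMap_eq fun _ => rfl
    have h : Spec.map (CommRingCat.ofHom (s.comp c.hom)) ≫ x =
        Spec.map (CommRingCat.ofHom s) ≫ Spec.map (CommRingCat.ofHom c.hom) ≫ x := by
      rw [← Category.assoc, ← Spec.map_comp, ← CommRingCat.ofHom_comp]
    have key := specMap_comp_rowPoint (B' := B') bs θ rfl rfl h c.l c.i c.hi
    exact key

theorem specMap_ofHom_injective {B C : Type u} [CommRing B] [CommRing C] {f g : B →+* C}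
    (h : Spec.map (CommRingCat.ofHom f) = Spec.map (CommRingCat.ofHom g)) : f = g :=
  congrArg CommRingCat.Hom.hom (Spec.map_injective h)

theorem toProjSpace_eq_iff {B : Type u} [CommRing B] {r r' : R →+* B}
    {l l' : Fin (n + 1) → B} {i j : Fin (n + 1)} (hi : l i = 1) (hj : l' j = 1) :
    toProjSpace ⟨B, r, l, i, hi⟩ = toProjSpace ⟨B, r', l', j, hj⟩ ↔
      r = r' ∧ ∀ a b, l a * l' b = l b * l' a := by
  rw [← coordPoint_eq_iff hi hj]
  constructor
  · intro h
    have h₁ := congrArg (· ≫ pullback.fst _ _) h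
    have h₂ := congrArg (· ≫ pullback.snd _ _) h
    simp only [toProjSpace_fst, toProjSpace_snd] at h₁ h₂
    exact ⟨specMap_ofHom_injective h₁, h₂⟩
  · rintro ⟨rfl, h⟩
    apply pullback.hom_ext
    · rw [toProjSpace_fst, toProjSpace_fst]
    · rw [toProjSpace_snd, toProjSpace_snd]
      exact h

theorem toBrauerSeveri_eq_iff (bs : BrauerSeveriOf n A P)
    (θ : A.obj R x ≃ₐ[R] Matrix (Fin (n + 1)) (Fin (n + 1)) R) {B : Type u} [CommRing B]
    {r r' : R →+* B} {l l' : Fin (n + 1) → B} {i j : Fin (n + 1)} (hi : l i = 1) (hj : l' j = 1) :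
    toBrauerSeveri bs θ ⟨B, r, l, i, hi⟩ = toBrauerSeveri bs θ ⟨B, r', l', j, hj⟩ ↔
      r = r' ∧ ∀ a b, l a * l' b = l b * l' a := by
  constructor
  · intro h
    have h₁ := congrArg (· ≫ pullback.fst _ _) h
    have h₂ := congrArg (· ≫ pullback.snd _ _) h
    simp only [toBrauerSeveri_fst, toBrauerSeveri_snd] at h₁ h₂
    obtain rfl := specMap_ofHom_injective h₁
    let := r.toAlgebra
    exact ⟨rfl, (rowPoint_eq_iff bs θ _ hi hj).mp (Subtype.ext h₂)⟩
  · rintro ⟨rfl, h⟩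
    apply pullback.hom_ext
    · rw [toBrauerSeveri_fst, toBrauerSeveri_fst]
    · rw [toBrauerSeveri_snd, toBrauerSeveri_snd]
      let := r.toAlgebra
      exact congrArg Subtype.val ((rowPoint_eq_iff bs θ _ hi hj).mpr h)

theorem hasLocalSections_toProjSpace (n : ℕ) (R : Type u) [CommRing R] :
    HasLocalSections fun c : RowVector n R => c.toProjSpace := by
  intro t
  obtain ⟨i, hi⟩ := exists_mem_range_awayι
    ((pullback.snd (terminal.from (Spec (.of R))) (terminal.from (projZ.{u} n))) t)
  let ι := Proj.awayι (grading.{u} n) (MvPolynomial.X i) (X_mem_grading i) one_pos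
  let q : pullback (terminal.from (Spec (.of R))) (terminal.from (projZ.{u} n)) ⟶
    Proj (grading.{u} n) := pullback.snd _ _
  obtain ⟨B, v, hv, hx, hsub⟩ := Scheme.exists_affine_mem_range_and_range_subset
    (U := q ⁻¹ᵁ ι.opensRange) (x := t) hi
  have hr : Set.range (v ≫ q) ⊆ Set.range ι := by
    rintro _ ⟨y, rfl⟩
    exact hsub ⟨y, rfl⟩
  obtain ⟨b, hb, hvb⟩ := exists_eq_coordPoint (B := B) (v := v ≫ q) hr
  let r : CommRingCat.of R ⟶ B := Spec.preimage (v ≫ pullback.fst _ _)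
  have hr : Spec.map r = v ≫ pullback.fst _ _ := Spec.map_preimage _
  let c : RowVector n R := ⟨B, r.hom, b, i, hb⟩
  refine ⟨Spec B, v, c, 𝟙 _, hv, hx, ?_⟩
  change 𝟙 (Spec (.of c.B)) ≫ c.toProjSpace = v
  rw [Category.id_comp]
  apply pullback.hom_ext
  · rw [toProjSpace_fst]
    exact hr
  · rw [toProjSpace_snd]
    exact hvb.symm

theorem hasLocalSections_toBrauerSeveri (bs : BrauerSeveriOf n A P)
    (θ : A.obj R x ≃ₐ[R] Matrix (Fin (n + 1)) (Fin (n + 1)) R) :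
    HasLocalSections fun c : RowVector n R => c.toBrauerSeveri bs θ := by
  intro t
  obtain ⟨B, _, v, hv, p, rfl⟩ := exists_spec_isOpenImmersion _ t
  obtain ⟨r, hr⟩ : ∃ r : R →+* B, Spec.map (CommRingCat.ofHom r) = v ≫ pullback.fst _ _ :=
    ⟨(Spec.preimage (v ≫ pullback.fst _ _)).hom, Spec.map_preimage _⟩
  let := r.toAlgebra
  let y : Spec (.of B) ⟶ S := Spec.map (CommRingCat.ofHom r) ≫ x
  have hs : (v ≫ pullback.snd x P.hom) ≫ P.hom = y := by
    rw [Category.assoc, ← pullback.condition, ← Category.assoc, ← hr]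
  obtain ⟨f, hf, H⟩ := exists_eq_rowPoint bs θ (y := y) rfl ⟨v ≫ pullback.snd x P.hom, hs⟩ p
  -- The localization is made opaque, since it carries an `R`-algebra structure of its own.
  obtain ⟨B', _, s, hopen, hmem, hunit⟩ : ∃ (B' : Type u) (_ : CommRing B') (s : B →+* B'),
      IsOpenImmersion (Spec.map (CommRingCat.ofHom s)) ∧
        v p ∈ Set.range (Spec.map (CommRingCat.ofHom s) ≫ v) ∧ IsUnit (s f) :=
    ⟨Localization.Away f, inferInstance, algebraMap B (Localization.Away f), inferInstance,
      mem_range_specMap_localizationAway_comp v p hf, IsLocalization.Away.algebraMap_isUnit f⟩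
  let : Algebra R B' := (s.comp r).toAlgebra
  let : Algebra B B' := s.toAlgebra
  have : IsScalarTower R B B' := .of_algebraMap_eq fun _ => rfl
  obtain ⟨l, i, hi, hl⟩ := H B' (Spec.map (CommRingCat.ofHom (s.comp r)) ≫ x) rfl (by
    change Spec.map (CommRingCat.ofHom (s.comp r)) ≫ x =
      Spec.map (CommRingCat.ofHom s) ≫ Spec.map (CommRingCat.ofHom r) ≫ x
    rw [← Category.assoc, ← Spec.map_comp, ← CommRingCat.ofHom_comp]) hunit
  let c : RowVector n R := ⟨B', s.comp r, l, i, hi⟩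
  refine ⟨Spec (.of B'), Spec.map (CommRingCat.ofHom s) ≫ v, c, 𝟙 _, inferInstance, hmem, ?_⟩
  change 𝟙 (Spec (.of c.B)) ≫ c.toBrauerSeveri bs θ = _
  rw [Category.id_comp]
  apply pullback.hom_ext
  · rw [toBrauerSeveri_fst, Category.assoc, ← hr, ← Spec.map_comp, ← CommRingCat.ofHom_comp]
  · rw [toBrauerSeveri_snd, Category.assoc]
    exact hl.symm

end RowVector

/-- The Brauer–Severi scheme of a matrix algebra over an affine scheme is a projective space. -/
theorem exists_iso_projSpace {n : ℕ} {R : Type u} [CommRing R] {S : Scheme.{u}} {A : Azumaya S}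
    {P : Over S} {x : Spec (.of R) ⟶ S} (bs : BrauerSeveriOf n A P)
    (θ : A.obj R x ≃ₐ[R] Matrix (Fin (n + 1)) (Fin (n + 1)) R) :
    ∃ e : pullback x P.hom ≅
        pullback (terminal.from (Spec (.of R))) (terminal.from (projZ.{u} n)),
      e.hom ≫ pullback.fst _ _ = pullback.fst _ _ := by
  refine exists_iso_of_hasLocalSections (RowVector.hasLocalSections_toBrauerSeveri bs θ)
    (RowVector.hasLocalSections_toProjSpace n R) _ _ (fun c => ?_) fun c c' B a b => ?_
  · rw [c.toBrauerSeveri_fst, c.toProjSpace_fst]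
  · obtain ⟨a, rfl⟩ : ∃ a' : c.B →+* B, Spec.map (CommRingCat.ofHom a') = a :=
      ⟨(Spec.preimage a).hom, Spec.map_preimage a⟩
    obtain ⟨b, rfl⟩ : ∃ b' : c'.B →+* B, Spec.map (CommRingCat.ofHom b') = b :=
      ⟨(Spec.preimage b).hom, Spec.map_preimage b⟩
    refine Iff.trans (b := (c.map a).toBrauerSeveri bs θ = (c'.map b).toBrauerSeveri bs θ) ?_
      (Iff.trans (b := (c.map a).toProjSpace = (c'.map b).toProjSpace) ?_ ?_)
    · rw [← c.specMap_comp_toBrauerSeveri, ← c'.specMap_comp_toBrauerSeveri]; rfl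
    · exact (RowVector.toBrauerSeveri_eq_iff bs θ (c.map a).hi (c'.map b).hi).trans
        (RowVector.toProjSpace_eq_iff (c.map a).hi (c'.map b).hi).symm
    · rw [← c.specMap_comp_toProjSpace, ← c'.specMap_comp_toProjSpace]; rfl

end Comparison

end

end BrauerSeveri

open BrauerSeveri CategoryTheory AlgebraicGeometry in
theorem lemma4p1 {S : Scheme.{u}} [AlgebraicGeometry.IsNoetherian S]
    (X : Over S) (hX : FiniteType X.hom)
    (n : ℕ) (P : Over S) (hP : IsBrauerSeveri n P)
    (β : Br S) (hβ : IsBrauerClass n P β) (h : β ∈ (Br.map X.hom).ker) :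
    cls (fiberProd X P) (finiteType_fiberProd hX hP.finiteType) =
      cls (projSpaceOver n X) (finiteType_projSpaceOver n hX) := by
  obtain ⟨A, ⟨bs⟩, rfl⟩ := hβ
  have hA : (A.pullback X.hom).BrauerEquiv (.trivial X.left) := Quotient.exact h
  -- The class of `X × P` and that of projective space over `X` are compared along the projections
  -- to `X`, over affine opens on which the algebra of `P` is a matrix algebra.
  refine cls_eq_of_locally_iso hX (FiniteType.fst X.hom hP.finiteType)
    (finiteType_projSpace n X.left) fun x => ?_
  obtain ⟨R, _, v, hv, hx, ⟨θ⟩⟩ := exists_algEquiv_matrix (m := n + 1)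
    (fun R _ v p => bs.degree R (v ≫ X.hom) p) hA x
  obtain ⟨e, he⟩ := exists_iso_projSpace (x := v ≫ X.hom) bs θ
  have ht : v ≫ terminal.from X.left = terminal.from _ := terminal.hom_ext _ _
  let i₁ := pullbackRightPullbackFstIso X.hom P.hom v
  let i₂ := pullbackRightPullbackFstIso (terminal.from X.left) (terminal.from (projZ.{u} n)) v
  refine ⟨_, v, hv, hx, i₁ ≪≫ e ≪≫ (pullback.congrHom ht rfl).symm ≪≫ i₂.symm, ?_⟩
  change (i₁.hom ≫ e.hom ≫ (pullback.congrHom ht rfl).inv ≫ i₂.inv) ≫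
    pullback.fst v (pullback.fst (terminal.from X.left) (terminal.from (projZ.{u} n))) = _
  have hc : (pullback.congrHom ht (rfl : terminal.from (projZ.{u} n) = _)).inv ≫
      pullback.fst _ _ = pullback.fst _ _ := by
    rw [pullback.congrHom_inv]
    exact (pullback.lift_fst _ _ _).trans (Category.comp_id _)
  simp only [Category.assoc, i₂, pullbackRightPullbackFstIso_inv_fst]
  rw [hc, he, pullbackRightPullbackFstIso_hom_fst]
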